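/- Let $T\ge 1$ and let $n,m,p,q$ be nonnegative integers. Consider the discrete-time optimal control problem $$\min\ \sum_{t=0}^{T-1}c_t(x_t,u_t)+c_T(x_T)$$ over control trajectories $(u_t)_{t=0}^{T-1}\subset\mathbb R^m$ and state trajectories $(x_t)_{t=0}^{T}\subset\mathbb R^n$ (the initial state being free apart from the constraints), subject to - $x_{t+1}=f_t(x_t,u_t)$ for $t=0,\dots,T-1$, - $x_t\in A_t$ for $t=0,\dots,T$ and $u_t\in U_t$ for $t=0,\dots,T-1$, where $A_t\subset\mathbb R^n$ and $U_t\subset\mathbb R^m$ are closed, - $\hat F(x_0,\dots,x_T):=\Upsilon_x+\sum_{t=0}^{T}\hat F_t(x_t)=0\in\mathbb R^p$ and $\hat G(u_0,\dots,u_{T-1}):=\Upsilon_u+\sum_{t=0}^{T-1}\hat G_t(u_t)=0\in\mathbb R^q$ (frequency constraints), where $\hat F_t:\mathbb R^n\to\mathbb R^p$ and $\hat G_t:\mathbb R^m\to\mathbb R^q$ are continuously differentiable. Notation. For a real function $h$ on a finite-dimensional space, $D_vh(x)=\lim_{\theta\downarrow0}\frac{h(x+\theta v)-h(x)}{\theta}$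 is the one-sided directional derivative and $h^\circ(x;v)=\limsup_{y\to x,\ \theta\downarrow 0}\frac{h(y+\theta v)-h(y)}{\theta}$ the generalized directional derivative. The function $h$ is *regular* at $x$ if it is Lipschitz continuous near $x$ and, for every $v$, $D_vh(x)$ exists and equals $h^\circ(x;v)$. For a closed set $S$ and $x\in S$, with $d_S$ the Euclidean distance to $S$, the Clarke tangent and normal cones are $\mathcal T_S(x)=\{v: d_S^\circ(x;v)\le 0\}$ and $\mathcal N_S(x)=\{\xi:\langle\xi,v\rangle\le 0\text{ for all }v\in \mathcal T_S(x)\}$. Dual vectors are identified with vectors through the Euclidean inner product. Assume that each $f_t:\mathbb R^n\times\mathbb R^m\to\mathbb R^n$ is continuously differentiable, that each stage cost $c_t:\mathbb R^n\times\mathbb R^m\to\mathbb R$, $t=0,\dots,T-1$, is regular at every point, and that the final cost $c_T:\mathbb R^n\to\mathbb R$ is regular at every point. Define the Hamiltonian $$H^{\lambda,\hat\eta^x,\hat\eta^u}(\zeta,t,\xi,\nu)=\langle\zeta,f_t(\xi,\nu)\rangle-\lambda c_t(\xi,\nu)-\langle\hat\eta^x,\hat F_t(\xi)\rangle-\langle\hat\eta^u,\hat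 G_t(\nu)\rangle .$$ Let $(u^*_t)_{t=0}^{T-1}$, with corresponding state trajectory $(x^*_t)_{t=0}^{T}$, solve the problem. Then there exist an adjoint trajectory $(\eta_t)_{t=0}^{T-1}\subset\mathbb R^n$, a sequence $(\mu_t)_{t=0}^{T}$ with $\mu_t\in\mathcal N_{A_t}(x^*_t)$ for every $t$, and $(\lambda,\hat\eta^x,\hat\eta^u)\in\mathbb R\times\mathbb R^p\times\mathbb R^q$ such that, with $H=H^{\lambda,\hat\eta^x,\hat\eta^u}$ and with all the directional derivatives below existing: 1. (non-negativity) $\lambda\in\{0,1\}$; 2. (non-triviality) $(\eta_t)_{t=0}^{T-1}$, $\lambda$, $\hat\eta^x$, $\hat\eta^u$ do not all vanish; 3. (state and adjoint dynamics) $x^*_{t+1}=\frac{\partial}{\partial\zeta}H(\eta_t,t,x^*_t,u^*_t)$ for $t=0,\dots,T-1$, and $\langle\eta_{t-1},y\rangle\ge D_yH(\eta_t,t,\cdot,u^*_t)(x^*_t)-\langle\mu_t,y\rangle$ for all $y\in\mathbb R^n$ and $t=1,\dots,T-1$; 4. (transversality) for all $y\in\mathbb R^n$, $D_yH(\eta_0,0,\cdot,u^*_0)(x^*_0)-\langle\mu_0,y\rangle\le0$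 and $$\langle\eta_{T-1},y\rangle+\lambda D_yc_T(x^*_T)+\Big\langle\Big(\tfrac{\partial \hat F_T}{\partial\xi}(x^*_T)\Big)^{\!\top}\hat\eta^x+\mu_T,\ y\Big\rangle\ge0;$$ 5. (Hamiltonian maximization) $D_vH(\eta_t,t,x^*_t,\cdot)(u^*_t)\le0$ for all $v\in\mathcal T_{U_t}(u^*_t)$ and $t=0,\dots,T-1$; 6. (frequency constraints) $\hat F(x^*_0,\dots,x^*_T)=0$ and $\hat G(u^*_0,\dots,u^*_{T-1})=0$. -/

import Mathlib

open Filter Topology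

noncomputable section

/-- `ℝⁿ` with its Euclidean norm and inner product. Dual vectors are identified with vectors
through the inner product. -/
abbrev Vec (n : ℕ) : Type := EuclideanSpace ℝ (Fin n)

section Nonsmooth

variable {E : Type*} [NormedAddCommGroup E]

/-- `h` is Lipschitz continuous on some neighbourhood of `x`. -/
def LipschitzNear (h : E → ℝ) (x : E) : Prop :=
  ∃ K : NNReal, ∃ s ∈ 𝓝 x, LipschitzOnWith K h s

/-- The (one-sided) directional derivative of `h` at `x` along `v` exists and equals `d`. -/
def HasDirDeriv [NormedSpace ℝ E] (h : E → ℝ) (x v : E) (d : ℝ) : Prop :=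
  Tendsto (fun θ : ℝ => (h (x + θ • v) - h x) / θ) (𝓝[>] 0) (𝓝 d)

/-- Clarke's generalized directional derivative
`h°(x; v) = limsup_{y → x, θ ↓ 0} (h (y + θ v) - h y) / θ`, as an extended real. -/
def genDirDeriv [NormedSpace ℝ E] (h : E → ℝ) (x v : E) : EReal :=
  limsup (fun p : E × ℝ => (((h (p.1 + p.2 • v) - h p.1) / p.2 : ℝ) : EReal))
    (𝓝 x ×ˢ 𝓝[>] (0 : ℝ))

/-- `h` is regular at `x`: it is Lipschitz near `x`, and at `x` its directional derivative along
every direction exists and equals the generalized directional derivative. This depends on the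
norm of `E` only up to equivalence. -/
def RegularAt [NormedSpace ℝ E] (h : E → ℝ) (x : E) : Prop :=
  LipschitzNear h x ∧ ∀ v : E, ∃ d : ℝ, HasDirDeriv h x v d ∧ genDirDeriv h x v = (d : EReal)

/-- The Clarke tangent cone to `S` at `x ∈ S`, defined by the distance function of `S`. -/
def clarkeTangentCone [NormedSpace ℝ E] (S : Set E) (x : E) : Set E :=
  {v | genDirDeriv (fun y => Metric.infDist y S) x v ≤ 0}

/-- The Clarke normal cone to `S` at `x ∈ S`: the polar of the Clarke tangent cone. -/
def clarkeNormalCone [InnerProductSpace ℝ E] (S : Set E) (x : E) : Set E :=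
  {ξ | ∀ v ∈ clarkeTangentCone S x, inner ℝ ξ v ≤ 0}

end Nonsmooth

/-- The data of the discrete-time optimal control problem with horizon `T`, state space `ℝⁿ`,
control space `ℝᵐ`, and frequency constraints with values in `ℝᵖ` (state) and `ℝ^q` (control). -/
structure ControlProblem (T n m p q : ℕ) where
  /-- the dynamics `f_t`, for `t = 0, …, T - 1` -/
  dyn : Fin T → Vec n × Vec m → Vec n
  /-- the stage costs `c_t`, for `t = 0, …, T - 1` -/
  stageCost : Fin T → Vec n × Vec m → ℝ
  /-- the final cost `c_T` -/
  finalCost : Vec n → ℝ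
  /-- the admissible states at time `t = 0, …, T` -/
  stateSet : Fin (T + 1) → Set (Vec n)
  /-- the admissible control actions at time `t = 0, …, T - 1` -/
  ctrlSet : Fin T → Set (Vec m)
  /-- the constant term of the frequency constraint on the states -/
  stateOffset : Vec p
  /-- the summands of the frequency constraint on the states, for `t = 0, …, T` -/
  stateFreq : Fin (T + 1) → Vec n → Vec p
  /-- the constant term of the frequency constraint on the controls -/
  ctrlOffset : Vec q
  /-- the summands of the frequency constraint on the controls, for `t = 0, …, T - 1` -/
  ctrlFreq : Fin T → Vec m → Vec q

namespace ControlProblem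

variable {T n m p q : ℕ} (P : ControlProblem T n m p q)

/-- The total cost of a state trajectory `x` and a control trajectory `u`. -/
def cost (x : Fin (T + 1) → Vec n) (u : Fin T → Vec m) : ℝ :=
  (∑ t : Fin T, P.stageCost t (x t.castSucc, u t)) + P.finalCost (x (Fin.last T))

/-- The map whose vanishing is the frequency constraint on the states. -/
def stateConstraint (x : Fin (T + 1) → Vec n) : Vec p :=
  P.stateOffset + ∑ t : Fin (T + 1), P.stateFreq t (x t)

/-- The map whose vanishing is the frequency constraint on the controls. -/
def ctrlConstraint (u : Fin T → Vec m) : Vec q :=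
  P.ctrlOffset + ∑ t : Fin T, P.ctrlFreq t (u t)

/-- `(x, u)` satisfies the dynamics and all the constraints. The initial state is only restricted
to the set of admissible states at time `0`. -/
structure Feasible (x : Fin (T + 1) → Vec n) (u : Fin T → Vec m) : Prop where
  dynamics : ∀ t : Fin T, x t.succ = P.dyn t (x t.castSucc, u t)
  state_mem : ∀ t : Fin (T + 1), x t ∈ P.stateSet t
  ctrl_mem : ∀ t : Fin T, u t ∈ P.ctrlSet t
  state_freq : P.stateConstraint x = 0
  ctrl_freq : P.ctrlConstraint u = 0

/-- `u`, with corresponding state trajectory `x`, solves the optimal control problem. -/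
def Solves (x : Fin (T + 1) → Vec n) (u : Fin T → Vec m) : Prop :=
  P.Feasible x u ∧ ∀ x' u', P.Feasible x' u' → P.cost x u ≤ P.cost x' u'

/-- The Hamiltonian, with multipliers `lam` (cost), `ηx`, `ηu` (frequency constraints on states
and controls) and `ζ` (adjoint variable), at time `t`, state `ξ` and control `ν`. -/
def hamiltonian (lam : ℝ) (ηx : Vec p) (ηu : Vec q) (ζ : Vec n) (t : Fin T)
    (ξ : Vec n) (ν : Vec m) : ℝ :=
  inner ℝ ζ (P.dyn t (ξ, ν)) - lam * P.stageCost t (ξ, ν)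
    - inner ℝ ηx (P.stateFreq t.castSucc ξ) - inner ℝ ηu (P.ctrlFreq t ν)

end ControlProblem

end

/-! The pair of trajectories is treated as one point `z` of a finite-dimensional space, minimizing a
locally Lipschitz cost `f` subject to `z ∈ C`, the closed product of all state and control sets, and
`h z = 0`, a smooth equation collecting dynamics and frequency constraints (`defect`).

`exists_multiplier` gives Fritz John conditions `0 ≤ l f°(z; v) + ⟨w, Dh(z) v⟩ + K D°(z; v)`, where
`D` sums the distances to the sets. Adding the squared distance to `z` makes the minimizer strict.
Minimizers of `f + k/2 ‖h‖²` on `C` near `z` then tend to `z`; at each one the constraint `C` is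
replaced by an exact distance penalty, the inequality is scaled so that `l + ‖w‖ = 1`, and
compactness gives the limit. Constraint values live in an ℓ² product, so that `w` is a vector;
trajectories keep the sup norm.

Testing this inequality only on perturbations of one state or one control yields all the conditions.
For a state, Hahn–Banach (`exists_linearMap_between`) turns the distance term into a normal vector
`μ t`; for a control, that term is nonpositive along tangent directions. Regularity converts Clarke
derivatives of the costs into directional derivatives, hence into those of the Hamiltonian. -/

set_option linter.unusedSectionVars false

/-! ### Clarke derivatives through upper bounds on difference quotients -/

section UpperBounds

variable {E F : Type*} [NormedAddCommGroup E] [NormedSpace ℝ E]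
  [NormedAddCommGroup F] [NormedSpace ℝ F]

/-- The difference quotients of `h` along `v` are at most `a` near `x`, for small positive steps. -/
def UpperDirBound (h : E → ℝ) (x v : E) (a : ℝ) : Prop :=
  ∀ᶠ p : E × ℝ in 𝓝 x ×ˢ 𝓝[>] (0 : ℝ), h (p.1 + p.2 • v) - h p.1 ≤ a * p.2

theorem eventually_snd_pos (x : E) :
    ∀ᶠ p : E × ℝ in 𝓝 x ×ˢ 𝓝[>] (0 : ℝ), 0 < p.2 :=
  tendsto_snd.eventually (self_mem_nhdsWithin)

theorem tendsto_add_smul (x v : E) :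
    Tendsto (fun p : E × ℝ => p.1 + p.2 • v) (𝓝 x ×ˢ 𝓝[>] (0 : ℝ)) (𝓝 x) := by
  have h : Tendsto (fun p : E × ℝ => p.1 + p.2 • v) (𝓝 (x, (0 : ℝ))) (𝓝 (x + (0 : ℝ) • v)) :=
    Continuous.tendsto (by fun_prop) _
  rw [zero_smul, add_zero, nhds_prod_eq] at h
  exact h.mono_left (prod_mono_right _ nhdsWithin_le_nhds)

theorem UpperDirBound.add {h₁ h₂ : E → ℝ} {x v : E} {a₁ a₂ : ℝ} (H₁ : UpperDirBound h₁ x v a₁)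
    (H₂ : UpperDirBound h₂ x v a₂) : UpperDirBound (fun y => h₁ y + h₂ y) x v (a₁ + a₂) := by
  filter_upwards [H₁, H₂] with p h1 h2
  linarith

theorem UpperDirBound.comp_clm {h : F → ℝ} (A : E →L[ℝ] F) {x v : E} {a : ℝ}
    (H : UpperDirBound h (A x) (A v) a) : UpperDirBound (fun y => h (A y)) x v a := by
  have ht : Tendsto (fun p : E × ℝ => (A p.1, p.2)) (𝓝 x ×ˢ 𝓝[>] (0 : ℝ))
      (𝓝 (A x) ×ˢ 𝓝[>] (0 : ℝ)) :=
    ((A.continuous.tendsto x).comp tendsto_fst).prodMk tendsto_snd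
  filter_upwards [ht.eventually H] with p hp
  simpa using hp

/-- Because the bound is joint in base point and step, it persists at all nearby base points. This
upper semicontinuity is what the limit of penalized minimizers needs. -/
theorem UpperDirBound.at_point {h : E → ℝ} {x v : E} {a : ℝ} (H : UpperDirBound h x v a) :
    ∀ᶠ y in 𝓝 x, ∀ᶠ θ in 𝓝[>] (0 : ℝ), h (y + θ • v) - h y ≤ a * θ :=
  Eventually.curry H

theorem LipschitzNear.exists_upperDirBound {h : E → ℝ} {x : E} (H : LipschitzNear h x) :
    ∃ K : ℝ, 0 ≤ K ∧ ∀ v, ∀ᶠ p : E × ℝ in 𝓝 x ×ˢ 𝓝[>] (0 : ℝ),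
      |h (p.1 + p.2 • v) - h p.1| ≤ K * ‖v‖ * p.2 := by
  obtain ⟨K, s, hs, hK⟩ := H
  refine ⟨K, K.2, fun v => ?_⟩
  filter_upwards [eventually_snd_pos x, (tendsto_add_smul x v).eventually hs,
    tendsto_fst.eventually hs] with p hp h1 h2
  have := hK.dist_le_mul _ h1 _ h2
  rw [Real.dist_eq, dist_eq_norm, add_sub_cancel_left, norm_smul, Real.norm_of_nonneg hp.le] at this
  linarith

/-- Clarke's generalized directional derivative as a real number. -/
noncomputable def clarkeDeriv (h : E → ℝ) (x v : E) : ℝ := (genDirDeriv h x v).toReal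

theorem genDirDeriv_le_of_upperDirBound {h : E → ℝ} {x v : E} {a : ℝ}
    (H : UpperDirBound h x v a) : genDirDeriv h x v ≤ a := by
  refine limsup_le_of_le (by isBoundedDefault) ?_
  filter_upwards [H, eventually_snd_pos x] with p h1 h2
  exact EReal.coe_le_coe_iff.2 ((div_le_iff₀ h2).2 h1)

/-- The Lipschitz constant bounds the quotients on both sides, so the upper limit is finite and
`toReal` loses nothing. -/
theorem LipschitzNear.coe_clarkeDeriv {h : E → ℝ} {x : E} (H : LipschitzNear h x) (v : E) :
    (clarkeDeriv h x v : EReal) = genDirDeriv h x v := by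
  obtain ⟨K, -, hK⟩ := H.exists_upperDirBound
  have h1 : genDirDeriv h x v ≤ ((K * ‖v‖ : ℝ) : EReal) := by
    refine genDirDeriv_le_of_upperDirBound ?_
    filter_upwards [hK v] with p hp using (abs_le.1 hp).2
  have h2 : ((-(K * ‖v‖) : ℝ) : EReal) ≤ genDirDeriv h x v := by
    refine le_limsup_of_frequently_le (Eventually.frequently ?_) (by isBoundedDefault)
    filter_upwards [hK v, eventually_snd_pos x] with p hp h2
    refine EReal.coe_le_coe_iff.2 ((le_div_iff₀ h2).2 ?_)
    have := (abs_le.1 hp).1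
    linarith
  refine EReal.coe_toReal (ne_top_of_le_ne_top (EReal.coe_ne_top _) h1)
    (ne_bot_of_le_ne_bot (EReal.coe_ne_bot _) h2)

/-- With `LipschitzNear.upperDirBound`, this exhibits the Clarke derivative as the infimum of the
eventual bounds `a`; sublinearity follows from the pair. -/
theorem LipschitzNear.clarkeDeriv_le {h : E → ℝ} {x : E} (H : LipschitzNear h x) {v : E} {a : ℝ}
    (ha : UpperDirBound h x v a) : clarkeDeriv h x v ≤ a := by
  have := genDirDeriv_le_of_upperDirBound ha
  rw [← H.coe_clarkeDeriv v] at this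
  exact EReal.coe_le_coe_iff.1 this

theorem LipschitzNear.upperDirBound {h : E → ℝ} {x : E} (H : LipschitzNear h x) {v : E} {a : ℝ}
    (ha : clarkeDeriv h x v < a) : UpperDirBound h x v a := by
  have h1 : genDirDeriv h x v < (a : EReal) := by
    rw [← H.coe_clarkeDeriv v]
    exact EReal.coe_lt_coe_iff.2 ha
  have h2 := eventually_lt_of_limsup_lt h1 (by isBoundedDefault)
  filter_upwards [h2, eventually_snd_pos x] with p hp hp2
  exact ((div_lt_iff₀ hp2).1 (EReal.coe_lt_coe_iff.1 hp)).le

/-- A step along `v + w` is a step along `v` followed by one along `w` from the shifted base point,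
which is allowed since base points vary in the upper limit. -/
theorem LipschitzNear.clarkeDeriv_add_le {h : E → ℝ} {x : E} (H : LipschitzNear h x) (v w : E) :
    clarkeDeriv h x (v + w) ≤ clarkeDeriv h x v + clarkeDeriv h x w := by
  refine le_of_forall_pos_le_add fun ε hε => ?_
  have h1 := H.upperDirBound (v := v) (a := clarkeDeriv h x v + ε / 2) (by linarith)
  have h2 := H.upperDirBound (v := w) (a := clarkeDeriv h x w + ε / 2) (by linarith)
  refine H.clarkeDeriv_le ?_
  have ht : Tendsto (fun p : E × ℝ => (p.1 + p.2 • v, p.2)) (𝓝 x ×ˢ 𝓝[>] (0 : ℝ))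
      (𝓝 x ×ˢ 𝓝[>] (0 : ℝ)) := (tendsto_add_smul x v).prodMk tendsto_snd
  filter_upwards [h1, ht.eventually h2] with p hp hq
  rw [smul_add, ← add_assoc]
  linarith

theorem LipschitzNear.clarkeDeriv_smul_le {h : E → ℝ} {x : E} (H : LipschitzNear h x) {c : ℝ}
    (hc : 0 < c) (v : E) : clarkeDeriv h x (c • v) ≤ c * clarkeDeriv h x v := by
  refine le_of_forall_pos_le_add fun ε hε => ?_
  have h1 := H.upperDirBound (v := v) (a := clarkeDeriv h x v + ε / c)
    (by have := div_pos hε hc; linarith)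
  refine H.clarkeDeriv_le ?_
  have hs : Tendsto (fun θ : ℝ => θ * c) (𝓝[>] 0) (𝓝[>] 0) := by
    refine tendsto_nhdsWithin_iff.2 ⟨?_, ?_⟩
    · have : Tendsto (fun θ : ℝ => θ * c) (𝓝 0) (𝓝 (0 * c)) :=
        Continuous.tendsto (by fun_prop) _
      rw [zero_mul] at this
      exact this.mono_left nhdsWithin_le_nhds
    · filter_upwards [self_mem_nhdsWithin] with θ hθ using mul_pos hθ hc
  have ht : Tendsto (fun p : E × ℝ => (p.1, p.2 * c)) (𝓝 x ×ˢ 𝓝[>] (0 : ℝ))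
      (𝓝 x ×ˢ 𝓝[>] (0 : ℝ)) := tendsto_fst.prodMk (hs.comp tendsto_snd)
  filter_upwards [ht.eventually h1] with p hp
  rw [smul_smul]
  refine hp.trans (le_of_eq ?_)
  field_simp

theorem LipschitzNear.clarkeDeriv_smul {h : E → ℝ} {x : E} (H : LipschitzNear h x) {c : ℝ}
    (hc : 0 < c) (v : E) : clarkeDeriv h x (c • v) = c * clarkeDeriv h x v := by
  refine le_antisymm (H.clarkeDeriv_smul_le hc v) ?_
  have := H.clarkeDeriv_smul_le (inv_pos.2 hc) (c • v)
  rw [smul_smul, inv_mul_cancel₀ hc.ne', one_smul] at this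
  calc c * clarkeDeriv h x v ≤ c * (c⁻¹ * clarkeDeriv h x (c • v)) := by gcongr
    _ = _ := by field_simp

theorem LipschitzNear.clarkeDeriv_zero {h : E → ℝ} {x : E} (H : LipschitzNear h x) :
    clarkeDeriv h x 0 = 0 := by
  have := H.clarkeDeriv_smul (c := 2) two_pos 0
  rw [smul_zero] at this
  linarith

theorem lipschitzNear_infDist (S : Set E) (x : E) :
    LipschitzNear (fun y => Metric.infDist y S) x :=
  ⟨1, Set.univ, univ_mem, (Metric.lipschitz_infDist_pt S).lipschitzOnWith⟩

/-- The sole use of regularity beyond Lipschitz continuity. -/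
theorem RegularAt.hasDirDeriv {h : E → ℝ} {x : E} (H : RegularAt h x) (v : E) :
    HasDirDeriv h x v (clarkeDeriv h x v) := by
  obtain ⟨d, hd, hd'⟩ := H.2 v
  rwa [clarkeDeriv, hd', EReal.toReal_coe]

theorem mem_clarkeTangentCone_iff {S : Set E} {x v : E} :
    v ∈ clarkeTangentCone S x ↔ clarkeDeriv (fun y => Metric.infDist y S) x v ≤ 0 := by
  change genDirDeriv _ x v ≤ 0 ↔ _
  rw [← (lipschitzNear_infDist S x).coe_clarkeDeriv v]
  exact EReal.coe_nonpos

/-- Two sublinear functions with nonnegative sum are separated by a linear functional. -/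
theorem exists_linearMap_between {p q : E → ℝ}
    (hp : ∀ c : ℝ, 0 < c → ∀ x, p (c • x) = c * p x) (hp' : ∀ x y, p (x + y) ≤ p x + p y)
    (hq : ∀ c : ℝ, 0 < c → ∀ x, q (c • x) = c * q x) (hq' : ∀ x y, q (x + y) ≤ q x + q y)
    (hpq : ∀ x, 0 ≤ p x + q x) :
    ∃ g : E →ₗ[ℝ] ℝ, (∀ x, -(g x) ≤ p x) ∧ ∀ x, g x ≤ q x := by
  have hp0 : p 0 = 0 := by
    have := hp 2 two_pos 0
    rw [smul_zero] at this
    linarith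
  have hq0 : q 0 = 0 := by
    have := hq 2 two_pos 0
    rw [smul_zero] at this
    linarith
  -- Hahn–Banach on `E × E`: the zero functional on the diagonal is dominated by `p ⊕ q`. Its
  -- extension vanishes on the diagonal, so its two components are opposite.
  obtain ⟨g, hg1, hg2⟩ := exists_extension_of_le_sublinear
    (E := E × E) ⟨LinearMap.range (LinearMap.prod LinearMap.id LinearMap.id : E →ₗ[ℝ] E × E), 0⟩
    (fun z => p z.1 + q z.2)
    (fun c hc z => by simp only [Prod.smul_fst, Prod.smul_snd, hp c hc, hq c hc]; ring)
    (fun z w => by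
      have h1 := hp' z.1 w.1
      have h2 := hq' z.2 w.2
      simp only [Prod.fst_add, Prod.snd_add]
      linarith)
    (by
      rintro ⟨_, x, rfl⟩
      simpa using hpq x)
  have hdiag : ∀ x, g (x, x) = 0 := fun x => by
    simpa using hg1 ⟨(x, x), ⟨x, rfl⟩⟩
  have hsplit : ∀ x, g (x, 0) = -g (0, x) := fun x => by
    have := hdiag x
    rw [show (x, x) = (x, (0 : E)) + ((0 : E), x) by simp, map_add] at this
    linarith
  refine ⟨g.comp (LinearMap.inr ℝ E E), fun x => ?_, fun x => ?_⟩
  · have := hg2 (x, 0)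
    simp only [hq0, add_zero, hsplit] at this
    simpa using this
  · have := hg2 (0, x)
    simp only [hp0, zero_add] at this
    simpa using this

/-- The upper limit of the difference quotients of `h` along `v`, near `x` and for small positive
steps, is at most `a`. -/
def UpperDirLimit (h : E → ℝ) (x v : E) (a : ℝ) : Prop :=
  ∀ ε : ℝ, 0 < ε → UpperDirBound h x v (a + ε)

theorem UpperDirLimit.add {h₁ h₂ : E → ℝ} {x v : E} {a₁ a₂ : ℝ} (H₁ : UpperDirLimit h₁ x v a₁)
    (H₂ : UpperDirLimit h₂ x v a₂) : UpperDirLimit (fun y => h₁ y + h₂ y) x v (a₁ + a₂) := by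
  intro ε hε
  have := (H₁ (ε / 2) (half_pos hε)).add (H₂ (ε / 2) (half_pos hε))
  rwa [show a₁ + ε / 2 + (a₂ + ε / 2) = a₁ + a₂ + ε by ring] at this

theorem UpperDirLimit.sum {ι : Type*} (s : Finset ι) {h : ι → E → ℝ} {x v : E} {a : ι → ℝ}
    (H : ∀ i, UpperDirLimit (h i) x v (a i)) :
    UpperDirLimit (fun y => ∑ i ∈ s, h i y) x v (∑ i ∈ s, a i) := by
  classical
  induction s using Finset.induction_on with
  | empty =>
    intro ε hε
    filter_upwards [eventually_snd_pos x] with p hp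
    simpa using (mul_pos hε hp).le
  | insert i s hi ih =>
    simp only [Finset.sum_insert hi]
    exact (H i).add ih

theorem UpperDirLimit.comp_clm {h : F → ℝ} (A : E →L[ℝ] F) {x v : E} {a : ℝ}
    (H : UpperDirLimit h (A x) (A v) a) : UpperDirLimit (fun y => h (A y)) x v a :=
  fun ε hε => (H ε hε).comp_clm A

theorem LipschitzNear.upperDirLimit {h : E → ℝ} {x : E} (H : LipschitzNear h x) (v : E) :
    UpperDirLimit h x v (clarkeDeriv h x v) :=
  fun _ hε => H.upperDirBound (lt_add_of_pos_right _ hε)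

end UpperBounds

/-! ### Fritz John conditions by penalization -/

section FritzJohn

variable {E W : Type*} [NormedAddCommGroup E] [NormedSpace ℝ E]
  [NormedAddCommGroup W] [InnerProductSpace ℝ W]

/-- Exact penalization at a local minimizer of `f + g` on `C`, where `D` bounds the distance
to `C`. -/
theorem nonneg_of_isLocalMinOn_add {f g D : E → ℝ} {C : Set E} {z v : E} {g' : E →L[ℝ] ℝ}
    {L M : NNReal} {s : Set E} {a b : ℝ} (hs : s ∈ 𝓝 z) (hf : LipschitzOnWith L f s)
    (hg : HasStrictFDerivAt g g' z) (hM : ‖g'‖₊ < M)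
    (hD : ∀ y, ∃ p ∈ C, dist y p ≤ D y) (hDz : D z = 0)
    (hmin : IsLocalMinOn (fun y => f y + g y) C z)
    (ha : ∀ᶠ θ in 𝓝[>] (0 : ℝ), f (z + θ • v) - f z ≤ a * θ)
    (hb : ∀ᶠ θ in 𝓝[>] (0 : ℝ), D (z + θ • v) - D z ≤ b * θ) :
    0 ≤ a + g' v + (L + M) * b := by
  obtain ⟨s', hs', hg'⟩ := hg.exists_lipschitzOnWith_of_nnnorm_lt M hM
  -- The competitors are points of `C` close to `z + θ • v`. As `D z = 0`, they lie within `b * θ`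
  -- of it, so they tend to `z`.
  choose P hPC hPD using hD
  have hz : Tendsto (fun θ : ℝ => z + θ • v) (𝓝[>] 0) (𝓝 z) := by
    have : Tendsto (fun θ : ℝ => z + θ • v) (𝓝 0) (𝓝 (z + (0 : ℝ) • v)) :=
      Continuous.tendsto (by fun_prop) _
    rw [zero_smul, add_zero] at this
    exact this.mono_left nhdsWithin_le_nhds
  have hbθ : Tendsto (fun θ : ℝ => b * θ) (𝓝[>] 0) (𝓝 0) := by
    have : Tendsto (fun θ : ℝ => b * θ) (𝓝 0) (𝓝 (b * 0)) :=
      Continuous.tendsto (by fun_prop) _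
    rw [mul_zero] at this
    exact this.mono_left nhdsWithin_le_nhds
  have hdist : ∀ᶠ θ in 𝓝[>] (0 : ℝ), dist (P (z + θ • v)) (z + θ • v) ≤ b * θ := by
    filter_upwards [hb] with θ hθ
    rw [dist_comm]
    linarith [hPD (z + θ • v)]
  have hP : Tendsto (fun θ : ℝ => P (z + θ • v)) (𝓝[>] 0) (𝓝 z) := by
    have h0 : Tendsto (fun θ : ℝ => dist (P (z + θ • v)) (z + θ • v)) (𝓝[>] 0) (𝓝 0) :=
      tendsto_of_tendsto_of_tendsto_of_le_of_le' tendsto_const_nhds hbθ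
        (Eventually.of_forall fun _ => dist_nonneg) hdist
    exact (tendsto_iff_of_dist h0).2 hz
  have hPm : Tendsto (fun θ : ℝ => P (z + θ • v)) (𝓝[>] 0) (𝓝[C] z) :=
    tendsto_nhdsWithin_iff.2 ⟨hP, Eventually.of_forall fun _ => hPC _⟩
  have hq : Tendsto (fun θ : ℝ => θ⁻¹ * (g (z + θ • v) - g z)) (𝓝[>] 0) (𝓝 (g' v)) := by
    have h1 : HasDerivAt (fun θ : ℝ => g (z + θ • v)) (g' v) 0 := by
      have h2 : HasDerivAt (fun θ : ℝ => z + θ • v) v 0 := by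
        simpa using ((hasDerivAt_id (0 : ℝ)).smul_const v).const_add z
      have h3 : HasFDerivAt g g' (z + (0 : ℝ) • v) := by simpa using hg.hasFDerivAt
      exact h3.comp_hasDerivAt 0 h2
    simpa using h1.tendsto_slope_zero_right
  refine ge_of_tendsto ((hq.const_add a).add_const ((L + M) * b)) ?_
  filter_upwards [ha, hdist, hPm.eventually hmin, hP.eventually hs, hP.eventually hs',
    hz.eventually hs, hz.eventually hs', self_mem_nhdsWithin] with θ h1 h2 h3 h4 h5 h6 h7 h8
  have h8 : 0 < θ := h8
  have hf1 := (le_abs_self _).trans (hf.dist_le_mul _ h4 _ h6)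
  have hg1 := (le_abs_self _).trans (hg'.dist_le_mul _ h5 _ h7)
  have e1 := mul_le_mul_of_nonneg_left h2 L.2
  have e2 := mul_le_mul_of_nonneg_left h2 M.2
  simp only [NNReal.val_eq_coe] at e1 e2
  -- Local minimality holds at the competitor; moving back to `z + θ • v` costs at most `(L + M) * b
  -- * θ`.
  have key : 0 ≤ a * θ + (g (z + θ • v) - g z) + (L + M) * b * θ := by
    have h3' : f z + g z ≤ f (P (z + θ • v)) + g (P (z + θ • v)) := h3
    linarith
  have := mul_nonneg (inv_nonneg.2 h8.le) key
  refine this.trans (le_of_eq ?_)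
  field_simp

/-- Fritz John conditions at a strict minimizer of a locally Lipschitz function under smooth
equality constraints and a closed abstract constraint, by quadratic penalization. -/
theorem exists_multiplier_of_strict [ProperSpace E] [ProperSpace W] {f D : E → ℝ} {h : E → W}
    {C : Set E} {z : E}
    (hf : LipschitzNear f z) (hh : ContDiff ℝ 1 h) (hC : IsClosed C)
    (hD : ∀ y, ∃ p ∈ C, dist y p ≤ D y) (hD0 : ∀ y ∈ C, D y = 0) (hz : z ∈ C) (hz0 : h z = 0)
    (hmin : ∀ y ∈ C, h y = 0 → y ≠ z → f z < f y) :
    ∃ (l : ℝ) (w : W) (K : ℝ), 0 ≤ l ∧ 0 ≤ K ∧ l + ‖w‖ = 1 ∧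
      ∀ v a b, UpperDirBound f z v a → UpperDirBound D z v b →
        0 ≤ l * a + inner ℝ w (fderiv ℝ h z v) + K * b := by
  obtain ⟨L, s, hs, hL⟩ := hf
  obtain ⟨r, hr, hrs⟩ := Metric.nhds_basis_closedBall.mem_iff.1 hs
  have hfc : ContinuousOn f (Metric.closedBall z r) := hL.continuousOn.mono hrs
  have hhc : Continuous h := hh.continuous
  have hB : IsCompact (C ∩ Metric.closedBall z r) := (isCompact_closedBall z r).inter_left hC
  have hzB : z ∈ C ∩ Metric.closedBall z r := ⟨hz, Metric.mem_closedBall_self hr.le⟩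
  have hfB : ContinuousOn f (C ∩ Metric.closedBall z r) := hfc.mono Set.inter_subset_right
  have hex : ∀ k : ℕ, ∃ y ∈ C ∩ Metric.closedBall z r,
      IsMinOn (fun y => f y + k / 2 * ‖h y‖ ^ 2) (C ∩ Metric.closedBall z r) y := fun k =>
    hB.exists_isMinOn ⟨z, hzB⟩ (hfB.add (Continuous.continuousOn (by fun_prop)))
  choose Z hZB hZmin using hex
  -- The penalty has derivative `⟨k h(Z k), Dh(Z k) v⟩`. Scaling by `l k` turns the coefficients of
  -- cost and constraint into `l k` and `w k` with `l k + ‖w k‖ = 1`, so they have a nonzero limit.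
  set l : ℕ → ℝ := fun k => (1 + k * ‖h (Z k)‖)⁻¹ with hl
  set w : ℕ → W := fun k => (l k * k) • h (Z k) with hw
  have hpos : ∀ k : ℕ, 0 < 1 + k * ‖h (Z k)‖ := fun k => by positivity
  have hl0 : ∀ k, 0 ≤ l k := fun k => (inv_pos.2 (hpos k)).le
  have hlw : ∀ k, l k + ‖w k‖ = 1 := fun k => by
    rw [hw]
    simp only [norm_smul, Real.norm_eq_abs, abs_mul, abs_of_nonneg (hl0 k), Nat.abs_cast]
    have := (hpos k).ne'
    simp only [hl]
    field_simp
  have hmem : ∀ k, (Z k, l k, w k) ∈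
      (C ∩ Metric.closedBall z r) ×ˢ (Set.Icc (0 : ℝ) 1 ×ˢ Metric.closedBall (0 : W) 1) :=
    fun k => ⟨hZB k, ⟨hl0 k, by linarith [hlw k, norm_nonneg (w k)]⟩, by
      rw [mem_closedBall_zero_iff]
      linarith [hlw k, hl0 k]⟩
  obtain ⟨⟨z', l', w'⟩, hmem', φ, hφ, hlim⟩ :=
    (hB.prod (isCompact_Icc.prod (isCompact_closedBall (0 : W) 1))).tendsto_subseq hmem
  have hZlim : Tendsto (fun k => Z (φ k)) atTop (𝓝 z') := (continuous_fst.tendsto _).comp hlim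
  have hllim : Tendsto (fun k => l (φ k)) atTop (𝓝 l') :=
    ((continuous_fst.comp continuous_snd).tendsto _).comp hlim
  have hwlim : Tendsto (fun k => w (φ k)) atTop (𝓝 w') :=
    ((continuous_snd.comp continuous_snd).tendsto _).comp hlim
  have hval : ∀ k : ℕ, f (Z k) + k / 2 * ‖h (Z k)‖ ^ 2 ≤ f z := fun k => by
    simpa [hz0] using hZmin k hzB
  have hfle : ∀ k, f (Z k) ≤ f z := fun k => by
    have : 0 ≤ (k : ℝ) / 2 * ‖h (Z k)‖ ^ 2 := by positivity
    linarith [hval k]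
  have hflim : Tendsto (fun k => f (Z (φ k))) atTop (𝓝 (f z')) :=
    (hfB z' hmem'.1).tendsto.comp
      (tendsto_nhdsWithin_iff.2 ⟨hZlim, Eventually.of_forall fun k => hZB _⟩)
  have hfz' : f z' ≤ f z := le_of_tendsto hflim (Eventually.of_forall fun k => hfle _)
  -- Since `f (Z k)` converges along the subsequence, `hval` forces `‖h (Z k)‖ ^ 2` to decay like `1
  -- / k`.
  have hhz' : h z' = 0 := by
    have h1 : Tendsto (fun k => ‖h (Z (φ k))‖ ^ 2) atTop (𝓝 (‖h z'‖ ^ 2)) :=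
      (((hhc.tendsto z').comp hZlim).norm).pow 2
    have h2 : Tendsto (fun k => 2 * (f z - f (Z (φ k))) / (φ k : ℝ)) atTop (𝓝 0) :=
      ((hflim.const_sub (f z)).const_mul 2).div_atTop
        (tendsto_natCast_atTop_atTop.comp hφ.tendsto_atTop)
    have h3 : ‖h z'‖ ^ 2 ≤ 0 := by
      refine le_of_tendsto_of_tendsto h1 h2 ?_
      filter_upwards [hφ.tendsto_atTop.eventually_gt_atTop 0] with k hk
      have hk' : (0 : ℝ) < φ k := by exact_mod_cast hk
      rw [le_div_iff₀ hk']
      linarith [hval (φ k)]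
    have := sq_nonneg ‖h z'‖
    simpa using le_antisymm h3 this
  have hzz : z' = z := by
    by_contra hne
    exact absurd (hmin z' hmem'.1.1 hhz' hne) (not_lt.2 hfz')
  subst hzz
  -- As `‖w k‖ ≤ 1`, this bounds the derivative of every scaled penalty near the limit. The exact
  -- penalty constant `L + M` is therefore independent of `k`.
  set M : NNReal := ‖fderiv ℝ h z'‖₊ + 1 with hM
  have hdc : Continuous (fderiv ℝ h) := hh.continuous_fderiv one_ne_zero
  have hMev : ∀ᶠ y in 𝓝 z', ‖fderiv ℝ h y‖₊ < M :=
    (hdc.nnnorm.tendsto z').eventually (gt_mem_nhds (lt_add_one _))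
  refine ⟨l', w', L + M, hmem'.2.1.1, by positivity, ?_, fun v a b ha hb => ?_⟩
  · exact tendsto_nhds_unique (hllim.add hwlim.norm)
      (tendsto_const_nhds.congr fun k => (hlw _).symm)
  have hlimit : Tendsto
      (fun k => l (φ k) * a + inner ℝ (w (φ k)) (fderiv ℝ h (Z (φ k)) v) + (L + M) * b) atTop
      (𝓝 (l' * a + inner ℝ w' (fderiv ℝ h z' v) + (L + M) * b)) := by
    have h1 : Tendsto (fun k => fderiv ℝ h (Z (φ k)) v) atTop (𝓝 (fderiv ℝ h z' v)) :=
      (Continuous.tendsto (by fun_prop : Continuous fun y => fderiv ℝ h y v) z').comp hZlim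
    exact ((hllim.mul_const a).add (hwlim.inner h1)).add_const _
  refine ge_of_tendsto hlimit ?_
  filter_upwards [hZlim.eventually ha.at_point, hZlim.eventually hb.at_point,
    hZlim.eventually hMev, hZlim.eventually (Metric.ball_mem_nhds z' hr)] with k h1 h2 h3 h4
  set n := φ k
  -- For large `k` the minimizer is interior to the ball, so it is a local minimizer on `C` itself.
  have hnb : Metric.closedBall z' r ∈ 𝓝 (Z n) :=
    mem_of_superset (Metric.isOpen_ball.mem_nhds h4) Metric.ball_subset_closedBall
  have hstrict : HasStrictFDerivAt h (fderiv ℝ h (Z n)) (Z n) :=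
    hh.contDiffAt.hasStrictFDerivAt one_ne_zero
  have hq := ((hasStrictFDerivAt_norm_sq (h (Z n))).comp (Z n) hstrict).const_mul (l n * n / 2)
  have hqe : ((l n * n / 2) • (2 • innerSL ℝ (h (Z n))).comp (fderiv ℝ h (Z n)) : E →L[ℝ] ℝ) =
      (innerSL ℝ (w n)).comp (fderiv ℝ h (Z n)) := by
    ext y
    simp only [hw, smul_apply, ContinuousLinearMap.comp_apply,
      innerSL_apply_apply, inner_smul_left, smul_eq_mul, nsmul_eq_mul]
    simp
    ring
  rw [hqe] at hq
  have hlL : LipschitzOnWith L (fun y => l n * f y) (Metric.closedBall z' r) := by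
    refine LipschitzOnWith.of_dist_le_mul fun x hx y hy => ?_
    have h5 := hL.dist_le_mul _ (hrs hx) _ (hrs hy)
    rw [Real.dist_eq] at h5 ⊢
    rw [← mul_sub, abs_mul, abs_of_nonneg (hl0 n)]
    have : l n ≤ 1 := (hmem n).2.1.2
    calc l n * |f x - f y| ≤ 1 * |f x - f y| := by gcongr
      _ ≤ _ := by rwa [one_mul]
  have hfin := nonneg_of_isLocalMinOn_add (C := C) (D := D) (v := v) (a := l n * a) (b := b)
    (M := M) hnb hlL hq
    (by
      refine lt_of_le_of_lt ?_ h3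
      refine NNReal.coe_le_coe.1 ?_
      simp only [coe_nnnorm]
      refine (ContinuousLinearMap.opNorm_comp_le _ _).trans ?_
      rw [innerSL_apply_norm]
      have : ‖w n‖ ≤ 1 := by simpa using (hmem n).2.2
      calc ‖w n‖ * ‖fderiv ℝ h (Z n)‖ ≤ 1 * ‖fderiv ℝ h (Z n)‖ := by gcongr
        _ = _ := one_mul _)
    hD (hD0 _ (hZB n).1)
    (by
      filter_upwards [self_mem_nhdsWithin, mem_nhdsWithin_of_mem_nhds hnb] with y hy1 hy2
      have h6 := mul_le_mul_of_nonneg_left (hZmin n ⟨hy1, hy2⟩) (hl0 n)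
      change l n * f (Z n) + l n * n / 2 * ‖h (Z n)‖ ^ 2 ≤ l n * f y + l n * n / 2 * ‖h y‖ ^ 2
      linarith)
    (by
      filter_upwards [h1] with θ hθ
      have h6 := mul_le_mul_of_nonneg_left hθ (hl0 n)
      linarith)
    h2
  simpa using hfin

/-- The squared distance to `z` has vanishing Clarke derivative at `z`. -/
theorem upperDirBound_dist_sq (z v : E) {ε : ℝ} (hε : 0 < ε) :
    UpperDirBound (fun y => dist y z ^ 2) z v ε := by
  have ht : Tendsto (fun p : E × ℝ => ‖v‖ * (dist (p.1 + p.2 • v) z + dist p.1 z))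
      (𝓝 z ×ˢ 𝓝[>] (0 : ℝ)) (𝓝 (‖v‖ * (dist z z + dist z z))) :=
    (((tendsto_add_smul z v).dist tendsto_const_nhds).add
      (tendsto_fst.dist tendsto_const_nhds)).const_mul _
  rw [dist_self, add_zero, mul_zero] at ht
  filter_upwards [ht.eventually (gt_mem_nhds hε), eventually_snd_pos z] with p h1 h2
  have h3 : dist (p.1 + p.2 • v) z - dist p.1 z ≤ p.2 * ‖v‖ := by
    have := dist_triangle (p.1 + p.2 • v) p.1 z
    rw [dist_eq_norm (p.1 + p.2 • v) p.1, add_sub_cancel_left, norm_smul,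
      Real.norm_of_nonneg h2.le] at this
    linarith
  have h4 : 0 ≤ dist (p.1 + p.2 • v) z + dist p.1 z := by positivity
  calc dist (p.1 + p.2 • v) z ^ 2 - dist p.1 z ^ 2
      = (dist (p.1 + p.2 • v) z - dist p.1 z) * (dist (p.1 + p.2 • v) z + dist p.1 z) := by ring
    _ ≤ (p.2 * ‖v‖) * (dist (p.1 + p.2 • v) z + dist p.1 z) := by gcongr
    _ = ‖v‖ * (dist (p.1 + p.2 • v) z + dist p.1 z) * p.2 := by ring
    _ ≤ ε * p.2 := by gcongr

theorem lipschitzNear_dist_sq (z : E) : LipschitzNear (fun y => dist y z ^ 2) z := by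
  refine ⟨2, Metric.ball z 1, Metric.ball_mem_nhds z one_pos,
    LipschitzOnWith.of_dist_le_mul fun x hx y hy => ?_⟩
  rw [Real.dist_eq, sq_sub_sq, abs_mul, mul_comm]
  have h1 : |dist x z - dist y z| ≤ dist x y := abs_dist_sub_le x y z
  have h2 : |dist x z + dist y z| ≤ 2 := by
    rw [abs_of_nonneg (by positivity)]
    have := Metric.mem_ball.1 hx
    have := Metric.mem_ball.1 hy
    linarith
  rw [mul_comm]
  exact mul_le_mul h2 h1 (abs_nonneg _) zero_le_two

theorem LipschitzNear.add {f g : E → ℝ} {z : E} (hf : LipschitzNear f z)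
    (hg : LipschitzNear g z) : LipschitzNear (fun y => f y + g y) z := by
  obtain ⟨K, s, hs, hK⟩ := hf
  obtain ⟨K', s', hs', hK'⟩ := hg
  exact ⟨K + K', s ∩ s', inter_mem hs hs',
    (hK.mono Set.inter_subset_left).add (hK'.mono Set.inter_subset_right)⟩

theorem LipschitzNear.comp_clm {F : Type*} [NormedAddCommGroup F] [NormedSpace ℝ F] {f : F → ℝ}
    (A : E →L[ℝ] F) {z : E} (hf : LipschitzNear f (A z)) : LipschitzNear (fun y => f (A y)) z := by
  obtain ⟨K, s, hs, hK⟩ := hf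
  exact ⟨K * ‖A‖₊, A ⁻¹' s, A.continuous.continuousAt hs,
    hK.comp A.lipschitz.lipschitzOnWith fun _ h => h⟩

/-- Fritz John conditions for a locally Lipschitz function under smooth equality constraints and
a closed abstract constraint. -/
theorem exists_multiplier [ProperSpace E] [ProperSpace W] {f D : E → ℝ} {h : E → W}
    {C : Set E} {z : E}
    (hf : LipschitzNear f z) (hh : ContDiff ℝ 1 h) (hC : IsClosed C)
    (hD : ∀ y, ∃ p ∈ C, dist y p ≤ D y) (hD0 : ∀ y ∈ C, D y = 0) (hz : z ∈ C) (hz0 : h z = 0)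
    (hmin : ∀ y ∈ C, h y = 0 → f z ≤ f y) :
    ∃ (l : ℝ) (w : W) (K : ℝ), (l = 0 ∨ l = 1) ∧ ¬(l = 0 ∧ w = 0) ∧ 0 ≤ K ∧
      ∀ v a b, UpperDirLimit f z v a → UpperDirLimit D z v b →
        0 ≤ l * a + inner ℝ w (fderiv ℝ h z v) + K * b := by
  obtain ⟨l, w, K, hl, hK, hlw, H⟩ := exists_multiplier_of_strict
    (hf.add (lipschitzNear_dist_sq z)) hh hC hD hD0 hz hz0 (fun y hy hy0 hne => by
      have := hmin y hy hy0
      have : 0 < dist y z := dist_pos.2 hne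
      have : 0 < dist y z ^ 2 := by positivity
      simp only [dist_self]
      linarith)
  have H' : ∀ v a b, UpperDirLimit f z v a → UpperDirLimit D z v b →
      0 ≤ l * a + inner ℝ w (fderiv ℝ h z v) + K * b := fun v a b ha hb => by
    refine le_of_forall_pos_le_add fun ε hε => ?_
    have hc : 0 < 2 * l + K + 1 := by positivity
    -- The errors are `δ` each from cost, squared distance and `D`: in total `(2 * l + K) * δ ≤ ε`.
    set δ := ε / (2 * l + K + 1) with hδ
    have hδ0 : 0 < δ := by positivity
    have h1 := H v _ _ ((ha δ hδ0).add (upperDirBound_dist_sq z v hδ0)) (hb δ hδ0)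
    have h2 : (2 * l + K + 1) * δ = ε := by
      rw [hδ]
      field_simp
    linarith
  -- If `l = 0` then `‖w‖ = 1`; otherwise dividing by `l` normalizes the cost multiplier to `1`.
  rcases hl.eq_or_lt with rfl | hl
  · refine ⟨0, w, K, Or.inl rfl, fun h0 => ?_, hK, H'⟩
    simp [h0.2] at hlw
  · refine ⟨1, l⁻¹ • w, l⁻¹ * K, Or.inr rfl, by simp, by positivity, fun v a b ha hb => ?_⟩
    have := mul_nonneg (inv_pos.2 hl).le (H' v a b ha hb)
    rw [real_inner_smul_left]
    refine this.trans (le_of_eq ?_)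
    field_simp

end FritzJohn

/-! ### Directional derivatives and normal vectors -/

section DirectionalCalculus

variable {E F : Type*} [NormedAddCommGroup E] [NormedSpace ℝ E]
  [NormedAddCommGroup F] [InnerProductSpace ℝ F]

theorem hasDerivAt_inner_comp_line {g : E → F} {x : E} (hg : DifferentiableAt ℝ g x) (v : E)
    (w : F) :
    HasDerivAt (fun θ : ℝ => inner ℝ w (g (x + θ • v))) (inner ℝ w (fderiv ℝ g x v)) 0 := by
  have h2 : HasDerivAt (fun θ : ℝ => x + θ • v) v 0 := by
    simpa using ((hasDerivAt_id (0 : ℝ)).smul_const v).const_add x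
  have h3 : HasFDerivAt g (fderiv ℝ g x) (x + (0 : ℝ) • v) := by simpa using hg.hasFDerivAt
  exact (innerSL ℝ w).hasFDerivAt.comp_hasDerivAt 0 (h3.comp_hasDerivAt 0 h2)

theorem hasDirDeriv_of_hasDerivAt {h : E → ℝ} {x v : E} {d : ℝ}
    (H : HasDerivAt (fun θ : ℝ => h (x + θ • v)) d 0) : HasDirDeriv h x v d := by
  refine H.tendsto_slope_zero_right.congr fun θ => ?_
  simp [div_eq_inv_mul]

theorem hasDirDeriv_inner_comp {g : E → F} {x : E} (hg : DifferentiableAt ℝ g x) (v : E) (w : F) :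
    HasDirDeriv (fun y => inner ℝ w (g y)) x v (inner ℝ w (fderiv ℝ g x v)) :=
  hasDirDeriv_of_hasDerivAt (hasDerivAt_inner_comp_line hg v w)

theorem HasDirDeriv.sub {f g : E → ℝ} {x v : E} {a b : ℝ} (hf : HasDirDeriv f x v a)
    (hg : HasDirDeriv g x v b) : HasDirDeriv (fun y => f y - g y) x v (a - b) :=
  (Tendsto.sub hf hg).congr fun θ => by ring

theorem HasDirDeriv.const_mul {f : E → ℝ} {x v : E} {a : ℝ} (c : ℝ) (hf : HasDirDeriv f x v a) :
    HasDirDeriv (fun y => c * f y) x v (c * a) :=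
  (Tendsto.const_mul c hf).congr fun θ => by ring

theorem hasDirDeriv_const (c : ℝ) (x v : E) : HasDirDeriv (fun _ => c) x v 0 := by
  simp [HasDirDeriv]

/-- A linear functional fits between `-p` and `K` times the Clarke derivative of the distance. The
latter is nonpositive on the tangent cone, so the Riesz vector of the functional is normal. -/
theorem exists_mem_clarkeNormalCone [FiniteDimensional ℝ F] {S : Set F} {x : F} {p : F → ℝ}
    {K : ℝ} (hK : 0 ≤ K) (hp : ∀ c : ℝ, 0 < c → ∀ y, p (c • y) = c * p y)
    (hp' : ∀ y z, p (y + z) ≤ p y + p z)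
    (h : ∀ y, 0 ≤ p y + K * clarkeDeriv (fun z => Metric.infDist z S) x y) :
    ∃ μ ∈ clarkeNormalCone S x, ∀ y, 0 ≤ p y + inner ℝ μ y := by
  have hL := lipschitzNear_infDist S x
  obtain ⟨g, hg1, hg2⟩ := exists_linearMap_between hp hp'
    (q := fun y => K * clarkeDeriv (fun z => Metric.infDist z S) x y)
    (fun c hc y => by simp only [hL.clarkeDeriv_smul hc]; ring)
    (fun y z => by
      have := mul_le_mul_of_nonneg_left (hL.clarkeDeriv_add_le y z) hK
      linarith) h
  have hμ : ∀ y, inner ℝ ((InnerProductSpace.toDual ℝ F).symm (LinearMap.toContinuousLinearMap g)) y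
      = g y := fun y => by
    rw [InnerProductSpace.toDual_symm_apply]
    rfl
  refine ⟨(InnerProductSpace.toDual ℝ F).symm (LinearMap.toContinuousLinearMap g),
    fun v hv => ?_, fun y => ?_⟩
  · rw [hμ]
    exact (hg2 v).trans (mul_nonpos_of_nonneg_of_nonpos hK (mem_clarkeTangentCone_iff.1 hv))
  · rw [hμ]
    linarith [hg1 y]

/-- Only `φ i 0 = 0` is required, not additivity, so that it applies to Clarke derivatives as well
as to linear terms. -/
theorem sum_pi_single_of_injective {ι κ M : Type*} [Fintype ι] [DecidableEq κ] [AddCommMonoid M]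
    {G : Type*} [Zero G] {g : ι → κ} (hg : Function.Injective g) {φ : ι → G → M}
    (hφ : ∀ i, φ i 0 = 0) (r : ι) (y : G) :
    ∑ i, φ i ((Pi.single (g r) y : κ → G) (g i)) = φ r y := by
  rw [Finset.sum_eq_single r]
  · simp
  · intro i _ hi
    rw [Pi.single_eq_of_ne (fun h => hi (hg h)), hφ]
  · simp

theorem sum_pi_single_of_ne {ι κ M : Type*} [Fintype ι] [DecidableEq κ] [AddCommMonoid M]
    {G : Type*} [Zero G] {g : ι → κ} {k : κ} (hg : ∀ i, g i ≠ k) {φ : ι → G → M}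
    (hφ : ∀ i, φ i 0 = 0) (y : G) :
    ∑ i, φ i ((Pi.single k y : κ → G) (g i)) = 0 :=
  Finset.sum_eq_zero fun i _ => by rw [Pi.single_eq_of_ne (hg i), hφ]

end DirectionalCalculus

/-! ### Dynamics and frequency constraints as one smooth equation -/

namespace ControlProblem

variable {T n m p q : ℕ} (P : ControlProblem T n m p q)

/-- The left-hand side of the equality constraints: dynamics and frequency constraints. -/
noncomputable def defect (z : (Fin (T + 1) → Vec n) × (Fin T → Vec m)) :
    WithLp 2 (PiLp 2 (fun _ : Fin T => Vec n) × WithLp 2 (Vec p × Vec q)) :=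
  WithLp.toLp 2 (WithLp.toLp 2 fun t => z.1 t.succ - P.dyn t (z.1 t.castSucc, z.2 t),
    WithLp.toLp 2 (P.stateConstraint z.1, P.ctrlConstraint z.2))

/-- The derivative along `(y, s)`, at `(x, u)`, of the equality constraints paired with
multipliers. -/
noncomputable def pairedDeriv (x : Fin (T + 1) → Vec n) (u : Fin T → Vec m) (η : Fin T → Vec n)
    (ηx : Vec p) (ηu : Vec q) (y : Fin (T + 1) → Vec n) (s : Fin T → Vec m) : ℝ :=
  ∑ t, inner ℝ (η t) (y t.succ)
    - ∑ t, inner ℝ (η t) (fderiv ℝ (P.dyn t) (x t.castSucc, u t) (y t.castSucc, s t))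
    + ∑ t, inner ℝ ηx (fderiv ℝ (P.stateFreq t) (x t) (y t))
    + ∑ t, inner ℝ ηu (fderiv ℝ (P.ctrlFreq t) (u t) (s t))

/-- The sum of the Clarke derivatives of all costs. -/
noncomputable def costDeriv (x : Fin (T + 1) → Vec n) (u : Fin T → Vec m)
    (y : Fin (T + 1) → Vec n) (s : Fin T → Vec m) : ℝ :=
  ∑ t, clarkeDeriv (P.stageCost t) (x t.castSucc, u t) (y t.castSucc, s t)
    + clarkeDeriv P.finalCost (x (Fin.last T)) (y (Fin.last T))

/-- The sum of the Clarke derivatives of all distances to the constraint sets. -/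
noncomputable def distDeriv (x : Fin (T + 1) → Vec n) (u : Fin T → Vec m)
    (y : Fin (T + 1) → Vec n) (s : Fin T → Vec m) : ℝ :=
  ∑ t, clarkeDeriv (fun ξ => Metric.infDist ξ (P.stateSet t)) (x t) (y t)
    + ∑ t, clarkeDeriv (fun ν => Metric.infDist ν (P.ctrlSet t)) (u t) (s t)

theorem contDiff_defect (hdyn : ∀ t, ContDiff ℝ 1 (P.dyn t))
    (hstateFreq : ∀ t, ContDiff ℝ 1 (P.stateFreq t))
    (hctrlFreq : ∀ t, ContDiff ℝ 1 (P.ctrlFreq t)) : ContDiff ℝ 1 P.defect := by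
  have h1 : ContDiff ℝ 1 (fun z : (Fin (T + 1) → Vec n) × (Fin T → Vec m) =>
      (WithLp.toLp 2 fun t => z.1 t.succ - P.dyn t (z.1 t.castSucc, z.2 t) :
        PiLp 2 (fun _ : Fin T => Vec n))) := by
    refine contDiff_piLp' _ fun t => ?_
    have := hdyn t
    change ContDiff ℝ 1 fun z : (Fin (T + 1) → Vec n) × (Fin T → Vec m) =>
      z.1 t.succ - P.dyn t (z.1 t.castSucc, z.2 t)
    fun_prop
  have h2 : ContDiff ℝ 1 (fun z : (Fin (T + 1) → Vec n) × (Fin T → Vec m) =>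
      P.stateConstraint z.1) := by
    unfold stateConstraint
    fun_prop
  have h3 : ContDiff ℝ 1 (fun z : (Fin (T + 1) → Vec n) × (Fin T → Vec m) =>
      P.ctrlConstraint z.2) := by
    unfold ctrlConstraint
    fun_prop
  exact (WithLp.contDiff_toLp).comp (h1.prodMk ((WithLp.contDiff_toLp).comp (h2.prodMk h3)))

theorem inner_defect (w : WithLp 2 (PiLp 2 (fun _ : Fin T => Vec n) × WithLp 2 (Vec p × Vec q)))
    (z : (Fin (T + 1) → Vec n) × (Fin T → Vec m)) :
    inner ℝ w (P.defect z) = ∑ t, inner ℝ (w.fst t) (z.1 t.succ)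
      - ∑ t, inner ℝ (w.fst t) (P.dyn t (z.1 t.castSucc, z.2 t))
      + (inner ℝ w.snd.fst P.stateOffset + ∑ t, inner ℝ w.snd.fst (P.stateFreq t (z.1 t)))
      + (inner ℝ w.snd.snd P.ctrlOffset + ∑ t, inner ℝ w.snd.snd (P.ctrlFreq t (z.2 t))) := by
  rw [WithLp.prod_inner_apply, WithLp.prod_inner_apply, PiLp.inner_apply]
  simp only [defect, stateConstraint, ctrlConstraint, inner_sub_right, inner_add_right, inner_sum,
    Finset.sum_sub_distrib]
  rw [← add_assoc]
  rfl

/-- Both sides are the derivative at `θ = 0` of the scalar function `⟨w, defect (z + θ v)⟩`, which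
`inner_defect` expands into sums over time. -/
theorem inner_fderiv_defect (hdyn : ∀ t, ContDiff ℝ 1 (P.dyn t))
    (hstateFreq : ∀ t, ContDiff ℝ 1 (P.stateFreq t))
    (hctrlFreq : ∀ t, ContDiff ℝ 1 (P.ctrlFreq t))
    (w : WithLp 2 (PiLp 2 (fun _ : Fin T => Vec n) × WithLp 2 (Vec p × Vec q)))
    (z v : (Fin (T + 1) → Vec n) × (Fin T → Vec m)) :
    inner ℝ w (fderiv ℝ P.defect z v) =
      P.pairedDeriv z.1 z.2 w.fst w.snd.fst w.snd.snd v.1 v.2 := by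
  have h1 := hasDerivAt_inner_comp_line
    ((P.contDiff_defect hdyn hstateFreq hctrlFreq).differentiable one_ne_zero z) v w
  refine h1.unique ?_
  simp only [inner_defect]
  refine HasDerivAt.add (HasDerivAt.add (HasDerivAt.sub ?_ ?_) ?_) ?_
  · refine HasDerivAt.fun_sum fun t _ => ?_
    have := hasDerivAt_inner_comp_line (differentiableAt_id (𝕜 := ℝ) (x := z.1 t.succ))
      (v.1 t.succ) (w.fst t)
    simpa using this
  · refine HasDerivAt.fun_sum fun t _ => ?_
    exact hasDerivAt_inner_comp_line (x := (z.1 t.castSucc, z.2 t))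
      ((hdyn t).differentiable one_ne_zero _) (v.1 t.castSucc, v.2 t) (w.fst t)
  · refine HasDerivAt.const_add _ (HasDerivAt.fun_sum fun t _ => ?_)
    exact hasDerivAt_inner_comp_line ((hstateFreq t).differentiable one_ne_zero _) _ _
  · refine HasDerivAt.const_add _ (HasDerivAt.fun_sum fun t _ => ?_)
    exact hasDerivAt_inner_comp_line ((hctrlFreq t).differentiable one_ne_zero _) _ _

end ControlProblem

/-! ### The multiplier rule for whole trajectories -/

namespace ControlProblem

variable {T n m p q : ℕ} (P : ControlProblem T n m p q)

/-- Evaluation of the state at time `t`. -/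
noncomputable def stateProj (t : Fin (T + 1)) :
    ((Fin (T + 1) → Vec n) × (Fin T → Vec m)) →L[ℝ] Vec n :=
  (ContinuousLinearMap.proj t).comp (ContinuousLinearMap.fst ℝ _ _)

/-- Evaluation of the control at time `t`. -/
noncomputable def ctrlProj (t : Fin T) :
    ((Fin (T + 1) → Vec n) × (Fin T → Vec m)) →L[ℝ] Vec m :=
  (ContinuousLinearMap.proj t).comp (ContinuousLinearMap.snd ℝ _ _)

theorem lipschitzNear_cost (hstageCost : ∀ t z, RegularAt (P.stageCost t) z)
    (hfinalCost : ∀ ξ, RegularAt P.finalCost ξ) (z : (Fin (T + 1) → Vec n) × (Fin T → Vec m)) :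
    LipschitzNear (fun z : (Fin (T + 1) → Vec n) × (Fin T → Vec m) => P.cost z.1 z.2) z := by
  have hsum : ∀ s : Finset (Fin T),
      LipschitzNear (fun z : (Fin (T + 1) → Vec n) × (Fin T → Vec m) =>
        ∑ t ∈ s, P.stageCost t (z.1 t.castSucc, z.2 t)) z := by
    intro s
    induction s using Finset.induction_on with
    | empty => exact ⟨0, Set.univ, univ_mem, by simp⟩
    | insert t s ht ih =>
      simp only [Finset.sum_insert ht]
      have h := LipschitzNear.comp_clm (z := z) ((stateProj t.castSucc).prod (ctrlProj t))
        (hstageCost t _).1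
      exact h.add ih
  have h := LipschitzNear.comp_clm (z := z) (stateProj (Fin.last T)) (hfinalCost _).1
  exact (hsum Finset.univ).add h

/-- The sum rule for Clarke derivatives is only an inequality, but an upper bound suffices in
`exists_multiplier`. -/
theorem upperDirLimit_cost (hstageCost : ∀ t z, RegularAt (P.stageCost t) z)
    (hfinalCost : ∀ ξ, RegularAt P.finalCost ξ)
    (z v : (Fin (T + 1) → Vec n) × (Fin T → Vec m)) :
    UpperDirLimit (fun z : (Fin (T + 1) → Vec n) × (Fin T → Vec m) => P.cost z.1 z.2) z v
      (P.costDeriv z.1 z.2 v.1 v.2) := by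
  have h1 (t : Fin T) := UpperDirLimit.comp_clm (x := z) (v := v)
    ((stateProj t.castSucc).prod (ctrlProj t)) ((hstageCost t _).1.upperDirLimit _)
  have h2 := UpperDirLimit.comp_clm (x := z) (v := v) (stateProj (Fin.last T))
    ((hfinalCost _).1.upperDirLimit _)
  exact (UpperDirLimit.sum Finset.univ h1).add h2

/-- The sum of the distances to all constraint sets. -/
noncomputable def distSum (z : (Fin (T + 1) → Vec n) × (Fin T → Vec m)) : ℝ :=
  ∑ t, Metric.infDist (z.1 t) (P.stateSet t) + ∑ t, Metric.infDist (z.2 t) (P.ctrlSet t)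

theorem upperDirLimit_distSum (z v : (Fin (T + 1) → Vec n) × (Fin T → Vec m)) :
    UpperDirLimit P.distSum z v (P.distDeriv z.1 z.2 v.1 v.2) := by
  have h1 (t : Fin (T + 1)) := UpperDirLimit.comp_clm (x := z) (v := v) (stateProj t)
    ((lipschitzNear_infDist (P.stateSet t) _).upperDirLimit _)
  have h2 (t : Fin T) := UpperDirLimit.comp_clm (x := z) (v := v) (ctrlProj t)
    ((lipschitzNear_infDist (P.ctrlSet t) _).upperDirLimit _)
  exact (UpperDirLimit.sum Finset.univ h1).add (UpperDirLimit.sum Finset.univ h2)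

/-- The trajectories satisfying the pointwise state and control constraints. -/
def admissible : Set ((Fin (T + 1) → Vec n) × (Fin T → Vec m)) :=
  {z | (∀ t, z.1 t ∈ P.stateSet t) ∧ ∀ t, z.2 t ∈ P.ctrlSet t}

theorem isClosed_admissible (hstateSet : ∀ t, IsClosed (P.stateSet t))
    (hctrlSet : ∀ t, IsClosed (P.ctrlSet t)) : IsClosed P.admissible := by
  have h1 : IsClosed {z : (Fin (T + 1) → Vec n) × (Fin T → Vec m) |
      ∀ t, z.1 t ∈ P.stateSet t} := by
    rw [Set.ofPred_forall]
    exact isClosed_iInter fun t =>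
      (hstateSet t).preimage ((continuous_apply t).comp continuous_fst)
  have h2 : IsClosed {z : (Fin (T + 1) → Vec n) × (Fin T → Vec m) |
      ∀ t, z.2 t ∈ P.ctrlSet t} := by
    rw [Set.ofPred_forall]
    exact isClosed_iInter fun t =>
      (hctrlSet t).preimage ((continuous_apply t).comp continuous_snd)
  exact h1.inter h2

theorem distSum_eq_zero {z : (Fin (T + 1) → Vec n) × (Fin T → Vec m)} (hz : z ∈ P.admissible) :
    P.distSum z = 0 := by
  simp [distSum, Metric.infDist_zero_of_mem (hz.1 _), Metric.infDist_zero_of_mem (hz.2 _)]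

/-- Nearest points are chosen coordinatewise; in the sup norm the distance is then the largest
summand of `distSum`. -/
theorem exists_mem_admissible_dist_le (hstateSet : ∀ t, IsClosed (P.stateSet t))
    (hctrlSet : ∀ t, IsClosed (P.ctrlSet t)) (hne : P.admissible.Nonempty)
    (z : (Fin (T + 1) → Vec n) × (Fin T → Vec m)) :
    ∃ z' ∈ P.admissible, dist z z' ≤ P.distSum z := by
  obtain ⟨w, hw⟩ := hne
  choose a ha ha' using fun t => (hstateSet t).exists_infDist_eq_dist ⟨_, hw.1 t⟩ (z.1 t)
  choose b hb hb' using fun t => (hctrlSet t).exists_infDist_eq_dist ⟨_, hw.2 t⟩ (z.2 t)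
  have h1 : 0 ≤ ∑ t, Metric.infDist (z.1 t) (P.stateSet t) :=
    Finset.sum_nonneg fun _ _ => Metric.infDist_nonneg
  have h2 : 0 ≤ ∑ t, Metric.infDist (z.2 t) (P.ctrlSet t) :=
    Finset.sum_nonneg fun _ _ => Metric.infDist_nonneg
  refine ⟨(a, b), ⟨ha, hb⟩, max_le ?_ ?_⟩
  · refine (dist_pi_le_iff (add_nonneg h1 h2)).2 fun t => ?_
    rw [← ha']
    have := Finset.single_le_sum (f := fun t => Metric.infDist (z.1 t) (P.stateSet t))
      (fun _ _ => Metric.infDist_nonneg) (Finset.mem_univ t)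
    exact this.trans (le_add_of_nonneg_right h2)
  · refine (dist_pi_le_iff (add_nonneg h1 h2)).2 fun t => ?_
    rw [← hb']
    have := Finset.single_le_sum (f := fun t => Metric.infDist (z.2 t) (P.ctrlSet t))
      (fun _ _ => Metric.infDist_nonneg) (Finset.mem_univ t)
    exact this.trans (le_add_of_nonneg_left h1)

theorem defect_eq_zero_iff (z : (Fin (T + 1) → Vec n) × (Fin T → Vec m)) :
    P.defect z = 0 ↔ (∀ t : Fin T, z.1 t.succ = P.dyn t (z.1 t.castSucc, z.2 t)) ∧
      P.stateConstraint z.1 = 0 ∧ P.ctrlConstraint z.2 = 0 := by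
  constructor
  · intro h
    refine ⟨fun t => sub_eq_zero.1 ?_, ?_, ?_⟩
    · exact congrArg (fun w => w.fst t) h
    · exact congrArg (fun w => w.snd.fst) h
    · exact congrArg (fun w => w.snd.snd) h
  · rintro ⟨h1, h2, h3⟩
    have h0 : (fun t : Fin T => z.1 t.succ - P.dyn t (z.1 t.castSucc, z.2 t)) = 0 :=
      funext fun t => sub_eq_zero.2 (h1 t)
    rw [defect, h0, h2, h3]
    rfl

/-- The multiplier rule for an optimal trajectory, before its separation in time. -/
theorem exists_multipliers
    (hdyn : ∀ t, ContDiff ℝ 1 (P.dyn t))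
    (hstageCost : ∀ t z, RegularAt (P.stageCost t) z)
    (hfinalCost : ∀ ξ, RegularAt P.finalCost ξ)
    (hstateSet : ∀ t, IsClosed (P.stateSet t))
    (hctrlSet : ∀ t, IsClosed (P.ctrlSet t))
    (hstateFreq : ∀ t, ContDiff ℝ 1 (P.stateFreq t))
    (hctrlFreq : ∀ t, ContDiff ℝ 1 (P.ctrlFreq t))
    {x : Fin (T + 1) → Vec n} {u : Fin T → Vec m} (hsol : P.Solves x u) :
    ∃ (η : Fin T → Vec n) (lam : ℝ) (ηx : Vec p) (ηu : Vec q) (K : ℝ),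
      (lam = 0 ∨ lam = 1) ∧ ¬ ((∀ t, η t = 0) ∧ lam = 0 ∧ ηx = 0 ∧ ηu = 0) ∧ 0 ≤ K ∧
      ∀ y s, 0 ≤ lam * P.costDeriv x u y s + P.pairedDeriv x u η ηx ηu y s
        + K * P.distDeriv x u y s := by
  have hmem : (x, u) ∈ P.admissible := ⟨hsol.1.state_mem, hsol.1.ctrl_mem⟩
  obtain ⟨l, w, K, hl, hlw, hK, H⟩ := exists_multiplier
    (P.lipschitzNear_cost hstageCost hfinalCost (x, u))
    (P.contDiff_defect hdyn hstateFreq hctrlFreq) (P.isClosed_admissible hstateSet hctrlSet)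
    (P.exists_mem_admissible_dist_le hstateSet hctrlSet ⟨_, hmem⟩)
    (fun _ => P.distSum_eq_zero) hmem
    ((P.defect_eq_zero_iff _).2 ⟨hsol.1.dynamics, hsol.1.state_freq, hsol.1.ctrl_freq⟩)
    (fun z hz hz0 => by
      obtain ⟨h1, h2, h3⟩ := (P.defect_eq_zero_iff z).1 hz0
      exact hsol.2 _ _ ⟨h1, hz.1, hz.2, h2, h3⟩)
  refine ⟨w.fst, l, w.snd.fst, w.snd.snd, K, hl, ?_, hK, fun y s => ?_⟩
  · rintro ⟨h1, h2, h3, h4⟩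
    refine hlw ⟨h2, ?_⟩
    refine (WithLp.ofLp_injective 2) (Prod.ext ?_ ((WithLp.ofLp_injective 2) (Prod.ext h3 h4)))
    exact (WithLp.ofLp_injective 2) (funext h1)
  · have := H (y, s) _ _ (P.upperDirLimit_cost hstageCost hfinalCost (x, u) (y, s))
      (P.upperDirLimit_distSum (x, u) (y, s))
    rwa [P.inner_fderiv_defect hdyn hstateFreq hctrlFreq] at this

/-! ### Perturbing a single state or control -/

section Separation

variable {P} {x : Fin (T + 1) → Vec n} {u : Fin T → Vec m} {η : Fin T → Vec n}
  {ηx : Vec p} {ηu : Vec q}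

theorem costDeriv_smul (hstageCost : ∀ t z, RegularAt (P.stageCost t) z)
    (hfinalCost : ∀ ξ, RegularAt P.finalCost ξ) {c : ℝ} (hc : 0 < c)
    (y : Fin (T + 1) → Vec n) (s : Fin T → Vec m) :
    P.costDeriv x u (c • y) (c • s) = c * P.costDeriv x u y s := by
  simp only [costDeriv, Pi.smul_apply, ← Prod.smul_mk, (hstageCost _ _).1.clarkeDeriv_smul hc,
    (hfinalCost _).1.clarkeDeriv_smul hc, mul_add, Finset.mul_sum]

theorem costDeriv_add_le (hstageCost : ∀ t z, RegularAt (P.stageCost t) z)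
    (hfinalCost : ∀ ξ, RegularAt P.finalCost ξ)
    (y y' : Fin (T + 1) → Vec n) (s s' : Fin T → Vec m) :
    P.costDeriv x u (y + y') (s + s') ≤ P.costDeriv x u y s + P.costDeriv x u y' s' := by
  have h1 := Finset.sum_le_sum fun t (_ : t ∈ Finset.univ) =>
    (hstageCost t (x t.castSucc, u t)).1.clarkeDeriv_add_le (y t.castSucc, s t)
      (y' t.castSucc, s' t)
  have h2 := (hfinalCost (x (Fin.last T))).1.clarkeDeriv_add_le (y (Fin.last T)) (y' (Fin.last T))
  rw [Finset.sum_add_distrib] at h1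
  simp only [costDeriv, Pi.add_apply]
  simp only [Prod.mk_add_mk] at h1
  linarith

theorem pairedDeriv_smul (c : ℝ) (y : Fin (T + 1) → Vec n) (s : Fin T → Vec m) :
    P.pairedDeriv x u η ηx ηu (c • y) (c • s) = c * P.pairedDeriv x u η ηx ηu y s := by
  simp only [pairedDeriv, Pi.smul_apply, ← Prod.smul_mk, map_smul, real_inner_smul_right, mul_add,
    mul_sub, Finset.mul_sum]

theorem pairedDeriv_add (y y' : Fin (T + 1) → Vec n) (s s' : Fin T → Vec m) :
    P.pairedDeriv x u η ηx ηu (y + y') (s + s') =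
      P.pairedDeriv x u η ηx ηu y s + P.pairedDeriv x u η ηx ηu y' s' := by
  simp only [pairedDeriv, Pi.add_apply, ← Prod.mk_add_mk, map_add, inner_add_right,
    Finset.sum_add_distrib]
  ring

theorem distDeriv_single_state (t : Fin (T + 1)) (y : Vec n) :
    P.distDeriv x u (Pi.single t y) 0 =
      clarkeDeriv (fun ξ => Metric.infDist ξ (P.stateSet t)) (x t) y := by
  rw [distDeriv, sum_pi_single_of_injective (g := fun t => t) Function.injective_id
    (φ := fun t y => clarkeDeriv (fun ξ => Metric.infDist ξ (P.stateSet t)) (x t) y)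
    (fun t => (lipschitzNear_infDist _ _).clarkeDeriv_zero)]
  simp [(lipschitzNear_infDist _ _).clarkeDeriv_zero]

theorem distDeriv_single_ctrl (t : Fin T) (v : Vec m) :
    P.distDeriv x u 0 (Pi.single t v) =
      clarkeDeriv (fun ν => Metric.infDist ν (P.ctrlSet t)) (u t) v := by
  rw [distDeriv, sum_pi_single_of_injective (g := fun t => t) Function.injective_id
    (φ := fun t y => clarkeDeriv (fun ξ => Metric.infDist ξ (P.ctrlSet t)) (u t) y)
    (fun t => (lipschitzNear_infDist _ _).clarkeDeriv_zero)]
  simp [(lipschitzNear_infDist _ _).clarkeDeriv_zero]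

theorem costDeriv_single_castSucc (hstageCost : ∀ t z, RegularAt (P.stageCost t) z)
    (hfinalCost : ∀ ξ, RegularAt P.finalCost ξ) (t : Fin T) (y : Vec n) :
    P.costDeriv x u (Pi.single t.castSucc y) 0 =
      clarkeDeriv (P.stageCost t) (x t.castSucc, u t) (y, 0) := by
  have h0 : ∀ t, clarkeDeriv (P.stageCost t) (x t.castSucc, u t) ((0 : Vec n), (0 : Vec m)) = 0 :=
    fun t => (hstageCost t _).1.clarkeDeriv_zero
  have h1 := sum_pi_single_of_injective (Fin.castSucc_injective T)
    (φ := fun t y => clarkeDeriv (P.stageCost t) (x t.castSucc, u t) (y, (0 : Vec m))) h0 t y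
  rw [costDeriv, Pi.single_eq_of_ne (Fin.castSucc_lt_last t).ne',
    (hfinalCost _).1.clarkeDeriv_zero, add_zero]
  exact h1

theorem costDeriv_single_last (hstageCost : ∀ t z, RegularAt (P.stageCost t) z) (y : Vec n) :
    P.costDeriv x u (Pi.single (Fin.last T) y) 0 =
      clarkeDeriv P.finalCost (x (Fin.last T)) y := by
  have h0 : ∀ t, clarkeDeriv (P.stageCost t) (x t.castSucc, u t) ((0 : Vec n), (0 : Vec m)) = 0 :=
    fun t => (hstageCost t _).1.clarkeDeriv_zero
  have h1 := sum_pi_single_of_ne (g := Fin.castSucc) (k := Fin.last T)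
    (fun t => (Fin.castSucc_lt_last t).ne)
    (φ := fun t y => clarkeDeriv (P.stageCost t) (x t.castSucc, u t) (y, (0 : Vec m))) h0 y
  rw [costDeriv, Pi.single_eq_same]
  exact (congrArg (· + _) h1).trans (zero_add _)

theorem costDeriv_single_ctrl (hstageCost : ∀ t z, RegularAt (P.stageCost t) z)
    (hfinalCost : ∀ ξ, RegularAt P.finalCost ξ) (t : Fin T) (v : Vec m) :
    P.costDeriv x u 0 (Pi.single t v) =
      clarkeDeriv (P.stageCost t) (x t.castSucc, u t) (0, v) := by
  have h0 : ∀ t, clarkeDeriv (P.stageCost t) (x t.castSucc, u t) ((0 : Vec n), (0 : Vec m)) = 0 :=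
    fun t => (hstageCost t _).1.clarkeDeriv_zero
  have h1 := sum_pi_single_of_injective (g := fun t : Fin T => t) Function.injective_id
    (φ := fun t v => clarkeDeriv (P.stageCost t) (x t.castSucc, u t) ((0 : Vec n), v)) h0 t v
  rw [costDeriv, Pi.zero_apply, (hfinalCost _).1.clarkeDeriv_zero, add_zero]
  exact h1

theorem sum_inner_fderiv_dyn_single_castSucc (t : Fin T) (y : Vec n) :
    ∑ r, inner ℝ (η r) (fderiv ℝ (P.dyn r) (x r.castSucc, u r)
      ((Pi.single t.castSucc y : Fin (T + 1) → Vec n) r.castSucc, (0 : Fin T → Vec m) r)) =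
      inner ℝ (η t) (fderiv ℝ (P.dyn t) (x t.castSucc, u t) (y, 0)) :=
  sum_pi_single_of_injective (Fin.castSucc_injective T)
    (φ := fun r y => inner ℝ (η r) (fderiv ℝ (P.dyn r) (x r.castSucc, u r) (y, (0 : Vec m))))
    (fun r => by rw [Prod.mk_zero_zero, map_zero, inner_zero_right]) t y

theorem sum_inner_fderiv_stateFreq_single (t : Fin (T + 1)) (y : Vec n) :
    ∑ r, inner ℝ ηx (fderiv ℝ (P.stateFreq r) (x r)
      ((Pi.single t y : Fin (T + 1) → Vec n) r)) =
      inner ℝ ηx (fderiv ℝ (P.stateFreq t) (x t) y) :=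
  sum_pi_single_of_injective (g := fun r => r) Function.injective_id
    (φ := fun r y => inner ℝ ηx (fderiv ℝ (P.stateFreq r) (x r) y))
    (fun r => by rw [map_zero, inner_zero_right]) t y

theorem sum_inner_single_succ (t : Fin T) (y : Vec n) :
    ∑ r, inner ℝ (η r) ((Pi.single t.succ y : Fin (T + 1) → Vec n) r.succ) = inner ℝ (η t) y :=
  sum_pi_single_of_injective (Fin.succ_injective T) (φ := fun r y => inner ℝ (η r) y)
    (fun _ => inner_zero_right _) t y

/-- An intermediate state enters the dynamics twice: as output of step `s = t - 1` and as input of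
step `t`. The initial state is only an input, the final one only an output. -/
theorem pairedDeriv_single_mid (s t : Fin T) (hst : t.castSucc = s.succ) (y : Vec n) :
    P.pairedDeriv x u η ηx ηu (Pi.single t.castSucc y) 0 =
      inner ℝ (η s) y - inner ℝ (η t) (fderiv ℝ (P.dyn t) (x t.castSucc, u t) (y, 0))
        + inner ℝ ηx (fderiv ℝ (P.stateFreq t.castSucc) (x t.castSucc) y) := by
  rw [pairedDeriv, sum_inner_fderiv_dyn_single_castSucc, sum_inner_fderiv_stateFreq_single]
  simp only [hst, sum_inner_single_succ]
  simp

theorem pairedDeriv_single_zero (t : Fin T) (ht : t.castSucc = 0) (y : Vec n) :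
    P.pairedDeriv x u η ηx ηu (Pi.single t.castSucc y) 0 =
      - inner ℝ (η t) (fderiv ℝ (P.dyn t) (x t.castSucc, u t) (y, 0))
        + inner ℝ ηx (fderiv ℝ (P.stateFreq t.castSucc) (x t.castSucc) y) := by
  rw [pairedDeriv, sum_inner_fderiv_dyn_single_castSucc, sum_inner_fderiv_stateFreq_single]
  simp [ht]

theorem pairedDeriv_single_last (s : Fin T) (hs : Fin.last T = s.succ) (y : Vec n) :
    P.pairedDeriv x u η ηx ηu (Pi.single (Fin.last T) y) 0 =
      inner ℝ (η s) y + inner ℝ ηx (fderiv ℝ (P.stateFreq (Fin.last T)) (x (Fin.last T)) y) := by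
  have h1 : ∑ r, inner ℝ (η r) (fderiv ℝ (P.dyn r) (x r.castSucc, u r)
      ((Pi.single (Fin.last T) y : Fin (T + 1) → Vec n) r.castSucc, (0 : Fin T → Vec m) r)) = 0 :=
    sum_pi_single_of_ne (fun t => (Fin.castSucc_lt_last t).ne)
      (φ := fun r y => inner ℝ (η r) (fderiv ℝ (P.dyn r) (x r.castSucc, u r) (y, (0 : Vec m))))
      (fun r => by rw [Prod.mk_zero_zero, map_zero, inner_zero_right]) y
  rw [pairedDeriv, h1, sum_inner_fderiv_stateFreq_single]
  simp only [hs, sum_inner_single_succ]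
  simp

theorem pairedDeriv_single_ctrl (t : Fin T) (v : Vec m) :
    P.pairedDeriv x u η ηx ηu 0 (Pi.single t v) =
      - inner ℝ (η t) (fderiv ℝ (P.dyn t) (x t.castSucc, u t) (0, v))
        + inner ℝ ηu (fderiv ℝ (P.ctrlFreq t) (u t) v) := by
  have h1 : ∑ r, inner ℝ (η r) (fderiv ℝ (P.dyn r) (x r.castSucc, u r)
      ((0 : Fin (T + 1) → Vec n) r.castSucc, (Pi.single t v : Fin T → Vec m) r)) =
      inner ℝ (η t) (fderiv ℝ (P.dyn t) (x t.castSucc, u t) (0, v)) :=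
    sum_pi_single_of_injective (g := fun r : Fin T => r) Function.injective_id
      (φ := fun r v => inner ℝ (η r) (fderiv ℝ (P.dyn r) (x r.castSucc, u r) ((0 : Vec n), v)))
      (fun r => by rw [Prod.mk_zero_zero, map_zero, inner_zero_right]) t v
  have h2 : ∑ r, inner ℝ ηu (fderiv ℝ (P.ctrlFreq r) (u r) ((Pi.single t v : Fin T → Vec m) r)) =
      inner ℝ ηu (fderiv ℝ (P.ctrlFreq t) (u t) v) :=
    sum_pi_single_of_injective (g := fun r : Fin T => r) Function.injective_id
      (φ := fun r v => inner ℝ ηu (fderiv ℝ (P.ctrlFreq r) (u r) v))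
      (fun r => by rw [map_zero, inner_zero_right]) t v
  rw [pairedDeriv, h1, h2]
  simp

/-- Joint regularity of the stage cost, applied along `(y, 0)`, gives the partial derivative with
the control frozen. -/
theorem hasDirDeriv_hamiltonian_state (hdyn : ∀ t, ContDiff ℝ 1 (P.dyn t))
    (hstageCost : ∀ t z, RegularAt (P.stageCost t) z)
    (hstateFreq : ∀ t, ContDiff ℝ 1 (P.stateFreq t)) (lam : ℝ) (ηx : Vec p) (ηu : Vec q)
    (ζ : Vec n) (t : Fin T) (ξ : Vec n) (ν : Vec m) (y : Vec n) :
    HasDirDeriv (fun ξ => P.hamiltonian lam ηx ηu ζ t ξ ν) ξ y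
      (inner ℝ ζ (fderiv ℝ (P.dyn t) (ξ, ν) (y, 0))
        - lam * clarkeDeriv (P.stageCost t) (ξ, ν) (y, 0)
        - inner ℝ ηx (fderiv ℝ (P.stateFreq t.castSucc) ξ y)) := by
  have hline : ∀ θ : ℝ, (ξ, ν) + θ • (y, (0 : Vec m)) = (ξ + θ • y, ν) := fun θ => by simp
  have h1 : HasDirDeriv (fun ξ => inner ℝ ζ (P.dyn t (ξ, ν))) ξ y
      (inner ℝ ζ (fderiv ℝ (P.dyn t) (ξ, ν) (y, 0))) := by
    have := hasDirDeriv_inner_comp ((hdyn t).differentiable one_ne_zero (ξ, ν)) (y, 0) ζ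
    simpa only [HasDirDeriv, hline] using this
  have h2 : HasDirDeriv (fun ξ => P.stageCost t (ξ, ν)) ξ y
      (clarkeDeriv (P.stageCost t) (ξ, ν) (y, 0)) := by
    have := (hstageCost t (ξ, ν)).hasDirDeriv (y, 0)
    simpa only [HasDirDeriv, hline] using this
  have h3 := hasDirDeriv_inner_comp ((hstateFreq t.castSucc).differentiable one_ne_zero ξ) y ηx
  have := ((h1.sub (h2.const_mul lam)).sub h3).sub
    (hasDirDeriv_const (inner ℝ ηu (P.ctrlFreq t ν)) ξ y)
  rwa [sub_zero] at this

theorem hasDirDeriv_hamiltonian_ctrl (hdyn : ∀ t, ContDiff ℝ 1 (P.dyn t))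
    (hstageCost : ∀ t z, RegularAt (P.stageCost t) z)
    (hctrlFreq : ∀ t, ContDiff ℝ 1 (P.ctrlFreq t)) (lam : ℝ) (ηx : Vec p) (ηu : Vec q)
    (ζ : Vec n) (t : Fin T) (ξ : Vec n) (ν v : Vec m) :
    HasDirDeriv (fun ν => P.hamiltonian lam ηx ηu ζ t ξ ν) ν v
      (inner ℝ ζ (fderiv ℝ (P.dyn t) (ξ, ν) (0, v))
        - lam * clarkeDeriv (P.stageCost t) (ξ, ν) (0, v)
        - inner ℝ ηu (fderiv ℝ (P.ctrlFreq t) ν v)) := by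
  have hline : ∀ θ : ℝ, (ξ, ν) + θ • ((0 : Vec n), v) = (ξ, ν + θ • v) := fun θ => by simp
  have h1 : HasDirDeriv (fun ν => inner ℝ ζ (P.dyn t (ξ, ν))) ν v
      (inner ℝ ζ (fderiv ℝ (P.dyn t) (ξ, ν) (0, v))) := by
    have := hasDirDeriv_inner_comp ((hdyn t).differentiable one_ne_zero (ξ, ν)) (0, v) ζ
    simpa only [HasDirDeriv, hline] using this
  have h2 : HasDirDeriv (fun ν => P.stageCost t (ξ, ν)) ν v
      (clarkeDeriv (P.stageCost t) (ξ, ν) (0, v)) := by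
    have := (hstageCost t (ξ, ν)).hasDirDeriv (0, v)
    simpa only [HasDirDeriv, hline] using this
  have h3 := hasDirDeriv_inner_comp ((hctrlFreq t).differentiable one_ne_zero ν) v ηu
  have := ((h1.sub (h2.const_mul lam)).sub
    (hasDirDeriv_const (inner ℝ ηx (P.stateFreq t.castSucc ξ)) ν v)).sub h3
  rwa [sub_zero] at this

theorem hasGradientAt_hamiltonian (lam : ℝ) (ηx : Vec p) (ηu : Vec q)
    (ζ : Vec n) (t : Fin T) (ξ : Vec n) (ν : Vec m) :
    HasGradientAt (fun ζ => P.hamiltonian lam ηx ηu ζ t ξ ν) (P.dyn t (ξ, ν)) ζ := by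
  have h := (InnerProductSpace.toDual ℝ (Vec n) (P.dyn t (ξ, ν))).hasFDerivAt (x := ζ)
  have h' := ((h.sub_const (lam * P.stageCost t (ξ, ν))).sub_const
    (inner ℝ ηx (P.stateFreq t.castSucc ξ))).sub_const (inner ℝ ηu (P.ctrlFreq t ν))
  refine HasFDerivAt.congr_of_eventuallyEq h' (Eventually.of_forall fun z => ?_)
  simp only [hamiltonian, InnerProductSpace.toDual_apply_apply, real_inner_comm]

end Separation

end ControlProblem

/-! ### Assembling the optimality conditions -/

theorem mainTheorem2 {T n m p q : ℕ} (hT : 0 < T) (P : ControlProblem T n m p q)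
    (hdyn : ∀ t, ContDiff ℝ 1 (P.dyn t))
    (hstageCost : ∀ t z, RegularAt (P.stageCost t) z)
    (hfinalCost : ∀ ξ, RegularAt P.finalCost ξ)
    (hstateSet : ∀ t, IsClosed (P.stateSet t))
    (hctrlSet : ∀ t, IsClosed (P.ctrlSet t))
    (hstateFreq : ∀ t, ContDiff ℝ 1 (P.stateFreq t))
    (hctrlFreq : ∀ t, ContDiff ℝ 1 (P.ctrlFreq t))
    (x : Fin (T + 1) → Vec n) (u : Fin T → Vec m) (hsol : P.Solves x u) :
    ∃ (η : Fin T → Vec n) (μ : Fin (T + 1) → Vec n) (lam : ℝ) (ηx : Vec p) (ηu : Vec q),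
      -- non-negativity
      (lam = 0 ∨ lam = 1) ∧
      -- non-triviality
      ¬ ((∀ t, η t = 0) ∧ lam = 0 ∧ ηx = 0 ∧ ηu = 0) ∧
      -- the pointwise state multipliers are normal vectors
      (∀ t, μ t ∈ clarkeNormalCone (P.stateSet t) (x t)) ∧
      -- state dynamics
      (∀ t : Fin T,
        HasGradientAt (fun ζ => P.hamiltonian lam ηx ηu ζ t (x t.castSucc) (u t))
          (x t.succ) (η t)) ∧
      -- adjoint dynamics, at the times t = s + 1 in {1, ..., T - 1}
      (∀ s t : Fin T, (t : ℕ) = s + 1 → ∀ y : Vec n, ∃ d : ℝ,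
        HasDirDeriv (fun ξ => P.hamiltonian lam ηx ηu (η t) t ξ (u t)) (x t.castSucc) y d ∧
          inner ℝ (η s) y ≥ d - inner ℝ (μ t.castSucc) y) ∧
      -- transversality at the initial time
      (∀ y : Vec n, ∃ d : ℝ,
        HasDirDeriv (fun ξ => P.hamiltonian lam ηx ηu (η ⟨0, hT⟩) ⟨0, hT⟩ ξ (u ⟨0, hT⟩))
          (x 0) y d ∧
          d - inner ℝ (μ 0) y ≤ 0) ∧
      -- transversality at the final time
      (∀ y : Vec n, ∃ d : ℝ,
        HasDirDeriv P.finalCost (x (Fin.last T)) y d ∧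
          inner ℝ (η ⟨T - 1, Nat.sub_lt hT Nat.one_pos⟩) y + lam * d
            + inner ℝ ((fderiv ℝ (P.stateFreq (Fin.last T)) (x (Fin.last T))).adjoint ηx
                + μ (Fin.last T)) y ≥ 0) ∧
      -- Hamiltonian maximization
      (∀ t : Fin T, ∀ v ∈ clarkeTangentCone (P.ctrlSet t) (u t), ∃ d : ℝ,
        HasDirDeriv (fun ν => P.hamiltonian lam ηx ηu (η t) t (x t.castSucc) ν) (u t) v d ∧
          d ≤ 0) ∧
      -- frequency constraints
      P.stateConstraint x = 0 ∧
      P.ctrlConstraint u = 0 := by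
  obtain ⟨η, lam, ηx, ηu, K, hlam, hnt, hK, H⟩ :=
    P.exists_multipliers hdyn hstageCost hfinalCost hstateSet hctrlSet hstateFreq hctrlFreq hsol
  have hμ : ∀ t, ∃ μ ∈ clarkeNormalCone (P.stateSet t) (x t), ∀ y,
      0 ≤ lam * P.costDeriv x u (Pi.single t y) 0
        + P.pairedDeriv x u η ηx ηu (Pi.single t y) 0 + inner ℝ μ y := fun t => by
    -- The sign of `lam` keeps `lam * costDeriv` subadditive, as the separation argument requires.
    have hlam0 : 0 ≤ lam := by rcases hlam with rfl | rfl <;> norm_num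
    refine exists_mem_clarkeNormalCone hK (p := fun y => lam * P.costDeriv x u (Pi.single t y) 0
        + P.pairedDeriv x u η ηx ηu (Pi.single t y) 0)
      (fun c hc y => ?_) (fun y z => ?_) fun y => ?_
    · have h1 := ControlProblem.costDeriv_smul (x := x) (u := u) hstageCost hfinalCost hc
        (Pi.single t y) 0
      have h2 := ControlProblem.pairedDeriv_smul (P := P) (x := x) (u := u) (η := η) (ηx := ηx)
        (ηu := ηu) c (Pi.single t y) 0
      rw [smul_zero, ← Pi.single_smul] at h1 h2
      rw [h1, h2]
      ring
    · have h1 := ControlProblem.costDeriv_add_le (x := x) (u := u) hstageCost hfinalCost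
        (Pi.single t y) (Pi.single t z) 0 0
      have h2 := ControlProblem.pairedDeriv_add (P := P) (x := x) (u := u) (η := η) (ηx := ηx)
        (ηu := ηu) (Pi.single t y) (Pi.single t z) 0 0
      rw [add_zero, ← Pi.single_add] at h1 h2
      rw [h2]
      have := mul_le_mul_of_nonneg_left h1 hlam0
      linarith
    · have := H (Pi.single t y) 0
      rwa [ControlProblem.distDeriv_single_state] at this
  choose μ hμN hμ using hμ
  refine ⟨η, μ, lam, ηx, ηu, hlam, hnt, hμN, fun t => ?_, fun s t hst y => ?_, fun y => ?_,
    fun y => ?_, fun t v hv => ?_, hsol.1.state_freq, hsol.1.ctrl_freq⟩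
  · rw [hsol.1.dynamics t]
    exact ControlProblem.hasGradientAt_hamiltonian _ _ _ _ _ _ _
  · refine ⟨_, ControlProblem.hasDirDeriv_hamiltonian_state hdyn hstageCost hstateFreq
      lam ηx ηu (η t) t (x t.castSucc) (u t) y, ?_⟩
    have := hμ t.castSucc y
    rw [ControlProblem.costDeriv_single_castSucc hstageCost hfinalCost,
      ControlProblem.pairedDeriv_single_mid s t (Fin.ext hst)] at this
    linarith
  · refine ⟨_, ControlProblem.hasDirDeriv_hamiltonian_state hdyn hstageCost hstateFreq
      lam ηx ηu (η ⟨0, hT⟩) ⟨0, hT⟩ (x 0) (u ⟨0, hT⟩) y, ?_⟩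
    have := hμ (Fin.castSucc ⟨0, hT⟩) y
    rw [ControlProblem.costDeriv_single_castSucc hstageCost hfinalCost,
      ControlProblem.pairedDeriv_single_zero ⟨0, hT⟩ rfl] at this
    change 0 ≤ lam * clarkeDeriv (P.stageCost ⟨0, hT⟩) (x 0, u ⟨0, hT⟩) (y, 0)
      + (-inner ℝ (η ⟨0, hT⟩) (fderiv ℝ (P.dyn ⟨0, hT⟩) (x 0, u ⟨0, hT⟩) (y, 0))
        + inner ℝ ηx (fderiv ℝ (P.stateFreq (Fin.castSucc ⟨0, hT⟩)) (x 0) y))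
      + inner ℝ (μ 0) y at this
    linarith
  · refine ⟨_, (hfinalCost _).hasDirDeriv y, ?_⟩
    have := hμ (Fin.last T) y
    rw [ControlProblem.costDeriv_single_last hstageCost,
      ControlProblem.pairedDeriv_single_last ⟨T - 1, Nat.sub_lt hT Nat.one_pos⟩
        (Fin.ext (Nat.succ_pred_eq_of_pos hT).symm)] at this
    rw [inner_add_left, ContinuousLinearMap.adjoint_inner_left]
    linarith
  · refine ⟨_, ControlProblem.hasDirDeriv_hamiltonian_ctrl hdyn hstageCost hctrlFreq
      lam ηx ηu (η t) t (x t.castSucc) (u t) v, ?_⟩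
    -- No separation is needed for controls: along a tangent direction the distance term is
    -- nonpositive and can be dropped.
    have := H 0 (Pi.single t v)
    rw [ControlProblem.costDeriv_single_ctrl hstageCost hfinalCost,
      ControlProblem.pairedDeriv_single_ctrl, ControlProblem.distDeriv_single_ctrl] at this
    have hd := mul_nonpos_of_nonneg_of_nonpos hK (mem_clarkeTangentCone_iff.1 hv)
    linarith
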